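/- Let $p$ be a prime and $m\ge 0$ an integer; for $\nu\ge 0$ put $q_\nu=q^{(m)}_\nu=\lfloor \nu/p^m\rfloor$. Let $\mathbb X=\mathbb P^1_{\mathbb Z_p}$, glued from $U_x=\mathrm{Spec}\,\mathbb Z_p[x]$ and $U_y=\mathrm{Spec}\,\mathbb Z_p[y]$ along $xy=1$, and let $\mathcal T$ be its relative tangent sheaf, with generators $\partial_x$ on $U_x$ and $\partial_y=-x^2\partial_x$ on $U_y$. Let $\mathcal D^{(m)}$ be the sheaf of arithmetic differential operators of level $m$ on $\mathbb X$: its sections over $U_t$ ($t\in\{x,y\}$) are the finite sums $\sum_\nu \gamma_\nu\frac{q_\nu!}{\nu!}\partial_t^\nu$ with $\gamma_\nu\in\mathbb Z_p[t]$, and $\mathcal D^{(m)}_d$ denotes the subsheaf of operators of order $\le d$. Let $\mathrm{Sym}(\mathcal T)^{(m)}$ be the graded sheaf of rings whose sections over $U_t$ form the $\mathbb Z_p[t]$-subalgebra of $\mathrm{Sym}(\mathcal T)\otimes\mathbb Q$ generated by the elements $\frac{q_i!}{i!}v^{i}$, where $i\ge 0$ and $v$ is a section of $\mathcal T$ over $U_t$.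 Let $\mathfrak g_{\mathbb Z_p}=\mathfrak{gl}_2(\mathbb Z_p)$, $\mathfrak g=\mathfrak{gl}_2(\mathbb Q_p)$, with the basis $e=\begin{pmatrix}0&1\\0&0\end{pmatrix}$, $h_1=\begin{pmatrix}1&0\\0&0\end{pmatrix}$, $h_2=\begin{pmatrix}0&0\\0&1\end{pmatrix}$, $f=\begin{pmatrix}0&0\\1&0\end{pmatrix}$. Let $U(\mathfrak g_{\mathbb Z_p})^{(m)}\subset U(\mathfrak g)$ be the $\mathbb Z_p$-subalgebra spanned over $\mathbb Z_p$ by the elements $$q_{\nu_1}!\frac{e^{\nu_1}}{\nu_1!}\cdot q_{\nu_2}!\binom{h_1}{\nu_2}\cdot q_{\nu_3}!\binom{h_2}{\nu_3}\cdot q_{\nu_4}!\frac{f^{\nu_4}}{\nu_4!},$$ filtered by letting the elements of degree $\le d$ be the span of those with $\nu_1+\nu_2+\nu_3+\nu_4\le d$. The assignment $e\mapsto\partial_x$, $h_1\mapsto -x\partial_x$, $h_2\mapsto x\partial_x$, $f\mapsto\partial_y$ induces a homomorphism of filtered $\mathbb Z_p$-algebras $$\xi^{(m)}: U(\mathfrak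 g_{\mathbb Z_p})^{(m)}\to H^0(\mathbb X,\mathcal D^{(m)}),$$ where the target is filtered by the submodules $H^0(\mathbb X,\mathcal D^{(m)}_d)$. It maps the center $Z(\mathfrak g_{\mathbb Z_p})$ of $U(\mathfrak g_{\mathbb Z_p})$ to $\mathbb Z_p$; let $\theta_0:Z(\mathfrak g_{\mathbb Z_p})\to\mathbb Z_p$ be its restriction to the center, put $$U(\mathfrak g_{\mathbb Z_p})^{(m)}_{\theta_0}=U(\mathfrak g_{\mathbb Z_p})^{(m)}\otimes_{Z(\mathfrak g_{\mathbb Z_p}),\theta_0}\mathbb Z_p,$$ and let $\xi^{(m)}_0:U(\mathfrak g_{\mathbb Z_p})^{(m)}_{\theta_0}\to H^0(\mathbb X,\mathcal D^{(m)})$ be the homomorphism induced by $\xi^{(m)}$. Then the following holds. (a) The canonical map (principal symbols) $$\mathrm{gr}\,H^0(\mathbb X,\mathcal D^{(m)})=\bigoplus_{d\ge0}H^0(\mathbb X,\mathcal D^{(m)}_d)/H^0(\mathbb X,\mathcal D^{(m)}_{d-1})\longrightarrow H^0(\mathbb X,\mathrm{Sym}(\mathcal T)^{(m)})$$ is an isomorphism,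 and via $\mathrm{gr}\,\xi^{(m)}:\mathrm{gr}\,U(\mathfrak g_{\mathbb Z_p})^{(m)}\to \mathrm{gr}\,H^0(\mathbb X,\mathcal D^{(m)})=H^0(\mathbb X,\mathrm{Sym}(\mathcal T)^{(m)})$ the ring $H^0(\mathbb X,\mathrm{Sym}(\mathcal T)^{(m)})$ is a finitely generated module over $\mathrm{gr}\,U(\mathfrak g_{\mathbb Z_p})^{(m)}$. (b) Via $\xi^{(m)}_0$ the ring $H^0(\mathbb X,\mathcal D^{(m)})$ is a finitely generated (left) $U(\mathfrak g_{\mathbb Z_p})^{(m)}_{\theta_0}$-module. Moreover, there is $N(m)\in\mathbb N$ such that the cokernel of $\xi^{(m)}_0$ is annihilated by $p^{N(m)}$. -/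

import Mathlib

noncomputable section

namespace ArithDiff

open scoped Nat

set_option linter.unusedSectionVars false

section Weights

variable (p : ℕ) [hp : Fact p.Prime] (m : ℕ)

/-- `q_n^{(m)} = ⌊n / p^m⌋`. -/
def q (n : ℕ) : ℕ := n / p ^ m

/-- The coefficient `q_n^{(m)}! / n!` of the divided powers of level `m`. -/
def w (n : ℕ) : ℚ_[p] := ((q p m n)! : ℚ_[p]) / (n ! : ℚ_[p])

variable {p} in
theorem fact_ne (n : ℕ) : (n ! : ℚ_[p]) ≠ 0 := by
  exact_mod_cast Nat.factorial_ne_zero n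

theorem w_ne (n : ℕ) : w p m n ≠ 0 := div_ne_zero (fact_ne _) (fact_ne _)

theorem w_zero : w p m 0 = 1 := by simp [w, q]

theorem w_one : w p m 1 = 1 := by
  have h : q p m 1 ≤ 1 := Nat.div_le_self _ _
  have h2 : (q p m 1)! = 1 := by interval_cases q p m 1 <;> rfl
  simp [w, h2]

theorem norm_fact_ratio (n : ℕ) :
    ‖((n / p)! : ℚ_[p]) / (n ! : ℚ_[p])‖ = (p : ℝ) ^ (n / p) := by
  have hp0 : (p : ℝ) ≠ 0 := by exact_mod_cast hp.out.ne_zero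
  have h1 : padicValNat p (n !) = padicValNat p ((n / p)!) + n / p := by
    rw [← padicValNat_factorial_mul, padicValNat_mul_div_factorial]
  rw [norm_div, Padic.norm_eq_zpow_neg_valuation (fact_ne _),
    Padic.norm_eq_zpow_neg_valuation (fact_ne _), Padic.valuation_natCast,
    Padic.valuation_natCast, h1, ← zpow_sub₀ hp0, ← zpow_natCast]
  congr 1
  push_cast
  ring

theorem norm_w (n : ℕ) : ‖w p m n‖ = (p : ℝ) ^ (∑ i ∈ Finset.range m, n / p ^ (i + 1)) := by
  induction m with
  | zero => simp [w, q, Nat.factorial_ne_zero]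
  | succ m ih =>
    have h : w p (m + 1) n =
        w p m n * (((n / p ^ m / p)! : ℚ_[p]) / ((n / p ^ m)! : ℚ_[p])) := by
      have := fact_ne (p := p) (n / p ^ m)
      rw [w, w, q, q, Nat.div_div_eq_div_mul, ← pow_succ]
      field_simp
    rw [h, norm_mul, ih, norm_fact_ratio, Finset.sum_range_succ, pow_add,
      Nat.div_div_eq_div_mul, ← pow_succ]

theorem norm_w_mul_le (a b : ℕ) : ‖w p m a * w p m b / w p m (a + b)‖ ≤ 1 := by
  have hp1 : (1 : ℝ) ≤ p := by exact_mod_cast hp.out.one_lt.le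
  have hp0 : (0 : ℝ) < p := by linarith
  rw [norm_div, norm_mul, norm_w, norm_w, norm_w, ← pow_add, ← Finset.sum_add_distrib]
  rw [div_le_one (pow_pos hp0 _)]
  apply pow_le_pow_right₀ hp1
  exact Finset.sum_le_sum fun i _ => Nat.div_add_div_le_add_div

variable {p} in
theorem norm_natCast_le (n : ℕ) : ‖(n : ℚ_[p])‖ ≤ 1 := by
  simpa using Padic.norm_int_le_one (p := p) (n : ℤ)

variable {p} in
theorem norm_div_le_of_dvd {a b : ℕ} (h : b ∣ a) : ‖(a : ℚ_[p]) / b‖ ≤ 1 := by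
  obtain ⟨c, rfl⟩ := h
  by_cases hb : (b : ℚ_[p]) = 0
  · simp [hb]
  · push_cast
    rw [mul_div_cancel_left₀ _ hb]
    exact norm_natCast_le c

theorem fact_w (n : ℕ) : (n ! : ℚ_[p]) * w p m n = ((q p m n)! : ℚ_[p]) := by
  rw [w, mul_div_cancel₀ _ (fact_ne n)]

theorem q_mono {a b : ℕ} (h : a ≤ b) : q p m a ≤ q p m b := Nat.div_le_div_right h

theorem q_add_le (a b : ℕ) : q p m a + q p m b ≤ q p m (a + b) := Nat.div_add_div_le_add_div

theorem w_succ_ratio (n : ℕ) : ‖w p m (n + 1) * ((n + 1 : ℕ) : ℚ_[p]) / w p m n‖ ≤ 1 := by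
  have h : w p m (n + 1) * ((n + 1 : ℕ) : ℚ_[p]) / w p m n =
      ((q p m (n + 1))! : ℚ_[p]) / ((q p m n)! : ℕ) := by
    have h0 := fact_ne (p := p) n
    have h1 := fact_ne (p := p) (n + 1)
    have h2 := fact_ne (p := p) (q p m n)
    have h3 : ((n + 1 : ℕ) : ℚ_[p]) ≠ 0 := by exact_mod_cast n.succ_ne_zero
    rw [w, w, Nat.factorial_succ, Nat.cast_mul]
    field_simp
  rw [h]
  exact norm_div_le_of_dvd (Nat.factorial_dvd_factorial (q_mono p m n.le_succ))

end Weights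

section Falling

variable {A : Type*} [Ring A]

/-- The falling factorial `h (h - 1) ⋯ (h - n + 1)`. -/
def ff (h : A) (n : ℕ) : A := Polynomial.aeval h (descPochhammer ℤ n)

theorem ff_zero (h : A) : ff h 0 = 1 := by simp [ff]

theorem ff_succ (h : A) (n : ℕ) : ff h (n + 1) = ff h n * (h - n) := by
  simp [ff, descPochhammer_succ_right]

theorem ff_one (h : A) : ff h 1 = h := by simp [ff]

theorem ff_succ_left (h : A) (n : ℕ) : ff h (n + 1) = h * ff (h - 1) n := by
  induction n with
  | zero => simp [ff]
  | succ n ih =>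
    rw [ff_succ, ih, ff_succ (h - 1), mul_assoc]
    congr 2
    push_cast
    abel

theorem ff_comm {h u : A} (c : A) (hc : h * u = u * c) (n : ℕ) : ff h n * u = u * ff c n := by
  induction n with
  | zero => simp [ff_zero]
  | succ n ih =>
    rw [ff_succ, ff_succ, mul_assoc, sub_mul, hc, (Nat.cast_commute n u).eq, ← mul_sub,
      ← mul_assoc, ih, mul_assoc]

theorem ff_comm' {h u : A} (c : A) (hc : u * h = c * u) (n : ℕ) : u * ff h n = ff c n * u := by
  induction n with
  | zero => simp [ff_zero]
  | succ n ih =>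
    rw [ff_succ, ff_succ, ← mul_assoc, ih, mul_assoc, mul_assoc, mul_sub, sub_mul, hc,
      (Nat.cast_commute n u).eq]

theorem ff_commute {h k : A} (hc : Commute h k) (a b : ℕ) : Commute (ff h a) (ff k b) := by
  have h1 : Commute (ff h a) k := (ff_comm (h := h) (u := k) h hc.eq a)
  exact (ff_comm (h := k) (u := ff h a) k h1.symm.eq b).symm

theorem ff_add {h k : A} (hc : Commute h k) (n : ℕ) :
    ff (h + k) n = ∑ ij ∈ Finset.HasAntidiagonal.antidiagonal n, (n.choose ij.1) • (ff h ij.1 * ff k ij.2) := by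
  have := Ring.descPochhammer_smeval_add n hc
  simpa [ff, Polynomial.aeval_eq_smeval] using this

theorem ff_neg (h : A) (n : ℕ) : ff (-h) n = (-1) ^ n * ff (h + n - 1) n := by
  induction n with
  | zero => simp [ff_zero]
  | succ n ih =>
    have e : h + ((n + 1 : ℕ) : A) - 1 = h + n := by push_cast; abel
    rw [ff_succ, ih, e, ff_succ_left, pow_succ]
    have h1 : Commute (ff (h + n - 1) n) (h + n) := by
      have := ff_commute (h := h + n - 1) (k := h + n)
        ((Commute.refl (h + (n : A))).sub_left (Commute.one_left _)) n 1
      rwa [ff_one] at this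
    rw [show -h - (n : A) = -(h + n) by abel, mul_neg, mul_assoc, h1.eq]
    simp

end Falling

section Spans

variable (p : ℕ) [hp : Fact p.Prime] (m : ℕ)
variable {A : Type*} [Ring A] [Algebra ℚ_[p] A] [Algebra ℤ_[p] A] [IsScalarTower ℤ_[p] ℚ_[p] A]

variable {p} in
theorem smul_mem_of_norm_le {N : Submodule ℤ_[p] A} {x : A} (hx : x ∈ N) {c : ℚ_[p]}
    (hc : ‖c‖ ≤ 1) : c • x ∈ N := by
  obtain ⟨z, rfl⟩ : ∃ z : ℤ_[p], algebraMap ℤ_[p] ℚ_[p] z = c := ⟨⟨c, hc⟩, rfl⟩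
  rw [algebraMap_smul]
  exact N.smul_mem z hx

variable {p} in
theorem mul_mem_of_span {X Y : Set A} {N : Submodule ℤ_[p] A}
    (h : ∀ x ∈ X, ∀ y ∈ Y, x * y ∈ N) {a b : A} (ha : a ∈ Submodule.span ℤ_[p] X)
    (hb : b ∈ Submodule.span ℤ_[p] Y) : a * b ∈ N := by
  have : Submodule.span ℤ_[p] X * Submodule.span ℤ_[p] Y ≤ N := by
    rw [Submodule.span_mul_span, Submodule.span_le]
    rintro _ ⟨x, hx, y, hy, rfl⟩
    exact h x hx y hy
  exact this (Submodule.mul_mem_mul ha hb)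

/-- `ℤ_p`-span of the divided powers of level `m` of `u`, of degree at most `d`. -/
def powSpan (u : A) (d : ℕ) : Submodule ℤ_[p] A :=
  Submodule.span ℤ_[p] {x | ∃ a ≤ d, x = w p m a • u ^ a}

/-- `ℤ_p`-span of the elements `q_b! (h choose b)` of degree at most `d`. -/
def ffSpan (h : A) (d : ℕ) : Submodule ℤ_[p] A :=
  Submodule.span ℤ_[p] {x | ∃ b ≤ d, x = w p m b • ff h b}

theorem pow_mem_powSpan (u : A) {a d : ℕ} (h : a ≤ d) : w p m a • u ^ a ∈ powSpan p m u d :=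
  Submodule.subset_span ⟨a, h, rfl⟩

theorem ff_mem_ffSpan (u : A) {a d : ℕ} (h : a ≤ d) : w p m a • ff u a ∈ ffSpan p m u d :=
  Submodule.subset_span ⟨a, h, rfl⟩

theorem powSpan_mono (u : A) {a d : ℕ} (h : a ≤ d) : powSpan p m u a ≤ powSpan p m u d :=
  Submodule.span_mono fun _ ⟨b, hb, e⟩ => ⟨b, hb.trans h, e⟩

theorem ffSpan_mono (u : A) {a d : ℕ} (h : a ≤ d) : ffSpan p m u a ≤ ffSpan p m u d :=
  Submodule.span_mono fun _ ⟨b, hb, e⟩ => ⟨b, hb.trans h, e⟩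

theorem smul_smul_div (a b : ℕ) (x : A) :
    (w p m a * w p m b) • x = (w p m a * w p m b / w p m (a + b)) • w p m (a + b) • x := by
  rw [smul_smul, div_mul_cancel₀ _ (w_ne p m _)]

theorem powSpan_mul {u : A} {i j : ℕ} {x y : A} (hx : x ∈ powSpan p m u i)
    (hy : y ∈ powSpan p m u j) : x * y ∈ powSpan p m u (i + j) := by
  refine mul_mem_of_span ?_ hx hy
  rintro _ ⟨a, ha, rfl⟩ _ ⟨b, hb, rfl⟩
  rw [smul_mul_smul_comm, ← pow_add, smul_smul_div]
  exact smul_mem_of_norm_le (pow_mem_powSpan p m u (by omega)) (norm_w_mul_le p m a b)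

theorem ff_add_one (h : A) (n : ℕ) : ff (h + 1) (n + 1) = ff h (n + 1) + (n + 1 : ℕ) • ff h n := by
  have hc : Commute (ff h n) h := by
    have := ff_commute (Commute.refl h) n 1
    rwa [ff_one] at this
  rw [ff_succ_left, add_sub_cancel_right, ff_succ, add_mul, ← hc.eq, mul_sub, nsmul_eq_mul]
  have := (Nat.cast_commute n (ff h n)).eq
  push_cast
  rw [add_mul, this]
  abel

theorem smul_ff_add_one (h : A) (n : ℕ) :
    w p m (n + 1) • ff (h + 1) (n + 1) = w p m (n + 1) • ff h (n + 1) +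
      (w p m (n + 1) * ((n + 1 : ℕ) : ℚ_[p]) / w p m n) • w p m n • ff h n := by
  rw [ff_add_one, smul_add, smul_smul _ (w p m n), div_mul_cancel₀ _ (w_ne p m _), mul_smul,
    Nat.cast_smul_eq_nsmul]

theorem ffSpan_add_one_le (h : A) (d : ℕ) : ffSpan p m (h + 1) d ≤ ffSpan p m h d := by
  rw [ffSpan, Submodule.span_le]
  rintro _ ⟨b, hb, rfl⟩
  rcases b with _ | b
  · have := ff_mem_ffSpan p m h (Nat.zero_le d)
    simpa [ff_zero] using this
  · rw [smul_ff_add_one]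
    exact add_mem (ff_mem_ffSpan p m h hb)
      (smul_mem_of_norm_le (ff_mem_ffSpan p m h (by omega)) (w_succ_ratio p m b))

theorem ffSpan_le_add_one (h : A) (d : ℕ) : ffSpan p m h d ≤ ffSpan p m (h + 1) d := by
  rw [ffSpan, Submodule.span_le]
  rintro _ ⟨b, hb, rfl⟩
  induction b with
  | zero =>
    have := ff_mem_ffSpan p m (h + 1) (Nat.zero_le d)
    simpa [ff_zero] using this
  | succ b ih =>
    have e := smul_ff_add_one p m h b
    rw [← sub_eq_iff_eq_add] at e
    rw [← e]
    exact sub_mem (ff_mem_ffSpan p m (h + 1) hb)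
      (smul_mem_of_norm_le (ih (by omega)) (w_succ_ratio p m b))

theorem ffSpan_add_nat (h : A) (s d : ℕ) : ffSpan p m (h + s) d = ffSpan p m h d := by
  induction s with
  | zero => simp
  | succ s ih =>
    rw [← ih, Nat.cast_succ, ← add_assoc]
    exact le_antisymm (ffSpan_add_one_le p m _ d) (ffSpan_le_add_one p m _ d)

theorem ffSpan_add_int (h : A) (s : ℤ) (d : ℕ) : ffSpan p m (h + s) d = ffSpan p m h d := by
  obtain ⟨n, rfl | rfl⟩ := s.eq_nat_or_neg
  · simpa using ffSpan_add_nat p m h n d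
  · have := ffSpan_add_nat p m (h + ((-n : ℤ) : A)) n d
    rw [← this]
    congr 1
    push_cast
    abel

theorem ff_add_index (h : A) (a b : ℕ) : ff h a * ff (h - a) b = ff h (a + b) := by
  induction b with
  | zero => simp [ff_zero]
  | succ b ih =>
    rw [ff_succ, ← mul_assoc, ih, ← add_assoc, ff_succ]
    congr 1
    push_cast
    abel

theorem ffSpan_mul {h : A} {i j : ℕ} {x y : A} (hx : x ∈ ffSpan p m h i)
    (hy : y ∈ ffSpan p m h j) : x * y ∈ ffSpan p m h (i + j) := by
  have key : ∀ a ≤ i, ∀ y ∈ ffSpan p m h j, w p m a • ff h a * y ∈ ffSpan p m h (i + j) := by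
    intro a ha y hy
    rw [← ffSpan_add_int p m h (-a)] at hy
    refine mul_mem_of_span (X := {w p m a • ff h a}) ?_ (Submodule.mem_span_singleton_self _) hy
    rintro _ rfl _ ⟨b, hb, rfl⟩
    have e : h + ((-a : ℤ) : A) = h - a := by push_cast; abel
    rw [e, smul_mul_smul_comm, ff_add_index, smul_smul_div]
    exact smul_mem_of_norm_le (ff_mem_ffSpan p m h (by omega)) (norm_w_mul_le p m a b)
  refine mul_mem_of_span (Y := (ffSpan p m h j : Set A)) ?_ hx (by simpa using hy)
  rintro _ ⟨a, ha, rfl⟩ y hy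
  exact key a ha y hy

theorem ffSpan_neg_le (h : A) (d : ℕ) : ffSpan p m (-h) d ≤ ffSpan p m h d := by
  rw [ffSpan, Submodule.span_le]
  rintro _ ⟨b, hb, rfl⟩
  have h1 : w p m b • ff (h + b - 1) b ∈ ffSpan p m h d := by
    rw [← ffSpan_add_int p m h (b - 1)]
    have e : h + b - 1 = h + ((b - 1 : ℤ) : A) := by push_cast; abel
    rw [e]
    exact ff_mem_ffSpan p m _ hb
  rw [ff_neg]
  rcases neg_one_pow_eq_or A b with e | e <;> rw [e]
  · simpa using h1
  · simpa using neg_mem h1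

/-- `ℤ_p`-span of the elements `q_b! (h choose b) q_c! (k choose c)`, `b + c ≤ d`. -/
def ffSpan₂ (h k : A) (d : ℕ) : Submodule ℤ_[p] A :=
  Submodule.span ℤ_[p] {x | ∃ b c, b + c ≤ d ∧ x = w p m b • ff h b * w p m c • ff k c}

theorem mul_mem_ffSpan₂ {h k : A} {i j d : ℕ} {x y : A} (hd : i + j ≤ d)
    (hx : x ∈ ffSpan p m h i) (hy : y ∈ ffSpan p m k j) : x * y ∈ ffSpan₂ p m h k d := by
  refine mul_mem_of_span ?_ hx hy
  rintro _ ⟨a, ha, rfl⟩ _ ⟨b, hb, rfl⟩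
  exact Submodule.subset_span ⟨a, b, by omega, rfl⟩

theorem ffSpan₂_mul {h k : A} (hc : Commute h k) {i j : ℕ} {x y : A}
    (hx : x ∈ ffSpan₂ p m h k i) (hy : y ∈ ffSpan₂ p m h k j) :
    x * y ∈ ffSpan₂ p m h k (i + j) := by
  refine mul_mem_of_span ?_ hx hy
  rintro _ ⟨a, b, ha, rfl⟩ _ ⟨a', b', hb, rfl⟩
  have e : Commute (w p m b • ff k b) (w p m a' • ff h a') :=
    ((ff_commute hc.symm b a').smul_left _).smul_right _
  rw [mul_assoc, ← mul_assoc (w p m b • ff k b), e.eq, mul_assoc, ← mul_assoc]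
  exact mul_mem_ffSpan₂ p m (i := a + a') (j := b + b') (by omega)
    (ffSpan_mul p m (ff_mem_ffSpan p m h le_rfl) (ff_mem_ffSpan p m h le_rfl))
    (ffSpan_mul p m (ff_mem_ffSpan p m k le_rfl) (ff_mem_ffSpan p m k le_rfl))

theorem ffSpan₂_shift (h k : A) (s t : ℤ) (d : ℕ) :
    ffSpan₂ p m (h + s) (k + t) d ≤ ffSpan₂ p m h k d := by
  rw [ffSpan₂, Submodule.span_le]
  rintro _ ⟨a, b, ha, rfl⟩
  refine mul_mem_ffSpan₂ p m ha ?_ ?_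
  · rw [← ffSpan_add_int p m h s]; exact ff_mem_ffSpan p m _ le_rfl
  · rw [← ffSpan_add_int p m k t]; exact ff_mem_ffSpan p m _ le_rfl

theorem ff_add_mem {h k : A} (hc : Commute h k) (n : ℕ) :
    w p m n • ff (h + k) n ∈ ffSpan₂ p m h k n := by
  rw [ff_add hc, Finset.smul_sum]
  refine sum_mem fun ij hij => ?_
  obtain ⟨i, j⟩ := ij
  have hij' : i + j = n := by simpa using hij
  subst hij'
  have e : w p m (i + j) • (i + j).choose i • (ff h i * ff k j) =
      (((q p m (i + j))! : ℚ_[p]) / (((q p m i)! * (q p m j)! : ℕ) : ℚ_[p])) •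
        (w p m i • ff h i * w p m j • ff k j) := by
    rw [smul_mul_smul_comm, smul_smul, ← Nat.cast_smul_eq_nsmul ℚ_[p], smul_smul]
    congr 1
    have h1 := fact_ne (p := p) i
    have h2 := fact_ne (p := p) j
    have h3 := fact_ne (p := p) (i + j)
    have h4 := fact_ne (p := p) (q p m i)
    have h5 := fact_ne (p := p) (q p m j)
    rw [w, w, w, Nat.cast_add_choose]
    push_cast
    field_simp
  simp only
  rw [e]
  have hm : w p m i • ff h i * w p m j • ff k j ∈ ffSpan₂ p m h k (i + j) :=
    Submodule.subset_span ⟨i, j, le_rfl, rfl⟩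
  refine smul_mem_of_norm_le hm ?_
  exact norm_div_le_of_dvd ((Nat.factorial_mul_factorial_dvd_factorial_add _ _).trans
    (Nat.factorial_dvd_factorial (q_add_le p m i j)))

theorem ff_neg_add_mem {h k : A} (hc : Commute h k) (s : ℤ) (n : ℕ) :
    w p m n • ff (-h + k + s) n ∈ ffSpan₂ p m h k n := by
  have h1 : Commute (-h) (k + (s : A)) := (hc.add_right (Int.commute_cast h s)).neg_left
  have h2 := ff_add_mem p m h1 n
  rw [← add_assoc] at h2
  refine Submodule.span_le.2 ?_ h2
  rintro _ ⟨a, b, ha, rfl⟩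
  refine mul_mem_ffSpan₂ p m ha (ffSpan_neg_le p m h a (ff_mem_ffSpan p m _ le_rfl)) ?_
  rw [← ffSpan_add_int p m k s]; exact ff_mem_ffSpan p m _ le_rfl

end Spans

section GL2

/-- The commutation relations of the standard basis `e, h₁, h₂, f` of `𝔤𝔩₂`. -/
structure GL2Rel {A : Type*} [Ring A] (e h k f : A) : Prop where
  he : h * e = e * (h + 1)
  ke : k * e = e * (k - 1)
  fh : f * h = (h + 1) * f
  fk : f * k = (k - 1) * f
  fe : f * e = e * f - (h - k)
  hk : Commute h k

variable {A : Type*} [Ring A] {e h k f : A}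

theorem GL2Rel.f_pow (r : GL2Rel e h k f) (c : ℕ) :
    f ^ (c + 1) * e = e * f ^ (c + 1) - (c + 1 : ℕ) • ((h - k + (c : ℤ)) * f ^ c) := by
  have hf : ∀ n : ℕ, f ^ n * (h - k) = (h - k + (2 * n : ℕ)) * f ^ n := by
    intro n
    induction n with
    | zero => simp
    | succ n ih =>
      have h1 : f * (h - k + (2 * n : ℕ)) = (h - k + (2 * (n + 1) : ℕ)) * f := by
        rw [mul_add, mul_sub, r.fh, r.fk, ← (Nat.cast_commute _ f).eq]
        push_cast
        noncomm_ring
      rw [pow_succ', mul_assoc, ih, ← mul_assoc, h1, mul_assoc]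
  induction c with
  | zero => simp [r.fe]
  | succ c ih =>
    rw [pow_succ f (c + 1), mul_assoc, r.fe, mul_sub, ← mul_assoc, ih, hf, sub_mul, smul_mul_assoc,
      mul_assoc e, ← pow_succ, mul_assoc (h - k + _), ← pow_succ, sub_sub]
    congr 1
    have h2 : ∀ (n : ℤ) (x : A), (n : A) * x = n • x := fun n x => by simp
    have h3 : ∀ (n : ℕ) (x : A), (n : A) * x = n • x := fun n x => by simp
    rw [add_mul, add_mul, add_mul, h2, h2, h3]
    push_cast
    module

theorem GL2Rel.kostant (r : GL2Rel e h k f) (a b : ℕ) :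
    f ^ b * e ^ a = ∑ j ∈ Finset.range (a + 1), (a.choose j * b.descFactorial j) •
      (e ^ (a - j) * ff (-h + k + ((2 * j - a - b : ℤ) : A)) j * f ^ (b - j)) := by
  have hf : ∀ j : ℕ, b.descFactorial j • (f ^ (b - j) * e) =
      b.descFactorial j • (e * f ^ (b - j)) -
        b.descFactorial (j + 1) • ((h - k + ((b - j - 1 : ℤ) : A)) * f ^ (b - (j + 1))) := by
    intro j
    rcases lt_trichotomy b j with hj | hj | hj
    · rw [Nat.descFactorial_of_lt hj, Nat.descFactorial_of_lt (hj.trans j.lt_succ_self)]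
      simp
    · subst hj
      rw [Nat.descFactorial_of_lt (Nat.lt_succ_self b)]
      simp
    · obtain ⟨c, rfl⟩ : ∃ c, b = j + (c + 1) := ⟨b - j - 1, by omega⟩
      have e1 : j + (c + 1) - j = c + 1 := by omega
      have e2 : j + (c + 1) - (j + 1) = c := by omega
      have e3 : (((j + (c + 1) : ℕ) : ℤ) - j - 1 : ℤ) = c := by push_cast; ring
      rw [Nat.descFactorial_succ, e1, e2, e3, r.f_pow, smul_sub, mul_comm, mul_smul]
  have hff : ∀ (s : ℤ) (j : ℕ), ff (-h + k + (s : A)) j * e = e * ff (-h + k + ((s - 2 : ℤ) : A)) j := by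
    intro s j
    refine ff_comm _ ?_ j
    rw [add_mul, add_mul, neg_mul, r.he, r.ke, (Int.cast_commute s e).eq]
    push_cast
    noncomm_ring
  induction a with
  | zero => simp [ff_zero]
  | succ a ih =>
    set P : ℕ → A := fun j => (a.choose j * b.descFactorial j) •
      (e ^ (a + 1 - j) * ff (-h + k + ((2 * j - a - b - 2 : ℤ) : A)) j * f ^ (b - j)) with hP
    set Q : ℕ → A := fun j => (a.choose j * b.descFactorial (j + 1)) •
      (e ^ (a - j) * ff (-h + k + ((2 * j - a - b : ℤ) : A)) j *
        ((h - k + ((b - j - 1 : ℤ) : A)) * f ^ (b - (j + 1)))) with hQ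
    have step : ∀ j ∈ Finset.range (a + 1), (a.choose j * b.descFactorial j) •
        (e ^ (a - j) * ff (-h + k + ((2 * j - a - b : ℤ) : A)) j * f ^ (b - j)) * e = P j - Q j := by
      intro j hj
      have hj' : j ≤ a := by simpa [Nat.lt_succ_iff] using hj
      rw [mul_smul, smul_mul_assoc, smul_mul_assoc, mul_assoc _ _ e, ← mul_smul_comm, hf, hP, hQ]
      simp only
      rw [mul_sub, smul_sub, mul_smul_comm, mul_smul_comm, mul_smul, mul_smul, ← mul_assoc _ e,
        mul_assoc _ _ e, hff, ← mul_assoc _ e, ← pow_succ, Nat.succ_sub hj']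
    have hlast : P (a + 1) = 0 := by simp [hP]
    rw [pow_succ, ← mul_assoc, ih, Finset.sum_mul, Finset.sum_congr rfl step,
      Finset.sum_sub_distrib, Finset.sum_range_succ' _ (a + 1)]
    have hPs : ∑ j ∈ Finset.range (a + 1), P j = ∑ j ∈ Finset.range (a + 1), P (j + 1) + P 0 := by
      rw [← Finset.sum_range_succ', Finset.sum_range_succ _ (a + 1), hlast, add_zero]
    rw [hPs, add_sub_right_comm, ← Finset.sum_sub_distrib]
    congr 1
    · refine Finset.sum_congr rfl fun j hj => ?_
      have hj' : j ≤ a := by simpa [Nat.lt_succ_iff] using hj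
      have e1 : a + 1 - (j + 1) = a - j := by omega
      simp only [hP, hQ]
      rw [e1]
      set y : A := -h + k + ((2 * j - a - b : ℤ) : A) with hy
      have y1 : -h + k + ((2 * (j + 1 : ℕ) - a - b - 2 : ℤ) : A) = y := by
        rw [hy]; congr 2; push_cast; ring
      have y2 : -h + k + ((2 * (j + 1 : ℕ) - (a + 1 : ℕ) - b : ℤ) : A) = y + 1 := by
        rw [hy]; push_cast; noncomm_ring
      have y3 : h - k + ((b - j - 1 : ℤ) : A) = -y + ((j - a - 1 : ℤ) : A) := by
        rw [hy]; push_cast; noncomm_ring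
      rw [y1, y2, y3, ff_succ, ff_succ_left, add_sub_cancel_right]
      have hc : (y + 1) * ff y j = ff y j * (y + 1) := by
        have := ff_commute (Commute.refl y) j 1
        rw [ff_one] at this
        exact ((this.add_right (Commute.one_right _)).symm).eq
      have key : (a.choose (j + 1) : ℤ) * (j + 1) = a.choose j * (a - j) := by
        have := Nat.choose_succ_right_eq a j
        zify [hj'] at this
        exact this
      have h2 : ∀ (n : ℤ) (x : A), x * (n : A) = n • x := fun n x => by
        rw [← (Int.cast_commute n x).eq]; simp
      have h3 : ∀ (n : ℕ) (x : A), x * (n : A) = n • x := fun n x => by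
        rw [← (Nat.cast_commute n x).eq]; simp
      clear_value y
      have key2 : a.choose (j + 1) • (ff y j * (y - j)) -
          a.choose j • (ff y j * (-y + ((j - a - 1 : ℤ) : A))) =
          (a.choose j + a.choose (j + 1)) • (ff y j * (y + 1)) := by
        rw [mul_sub, mul_add, mul_add, h2, h3, mul_neg, mul_one]
        linear_combination (norm := module) (-key) • (ff y j)
      rw [hc, Nat.choose_succ_succ, mul_comm _ (b.descFactorial _),
        mul_comm _ (b.descFactorial _), mul_comm _ (b.descFactorial _), mul_smul, mul_smul,
        mul_smul, ← smul_sub]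
      congr 1
      have h4 : ∀ (n : ℕ) (x y z : A), n • (x * y * z) = x * (n • y) * z := by
        intro n x y z
        rw [mul_smul_comm, smul_mul_assoc]
      rw [h4, ← mul_assoc _ _ (f ^ (b - (j + 1))), mul_assoc (e ^ (a - j)) _ (-y + _), h4, h4,
        ← sub_mul, ← mul_sub, key2]
    · simp [hP, ff_zero]

end GL2

section Filtered

/-- An increasing, multiplicative `ℕ`-indexed filtration `F 0 ⊆ F 1 ⊆ ⋯` by submodules of an
algebra `B`. It exhausts the subalgebra `⋃ F d`, which need not be all of `B`. -/
structure RingFil (R B : Type*) [CommRing R] [Ring B] [Algebra R B] where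
  F : ℕ → Submodule R B
  mono : Monotone F
  one_mem : 1 ∈ F 0
  mul_mem : ∀ {i j : ℕ} {x y : B}, x ∈ F i → y ∈ F j → x * y ∈ F (i + j)

namespace RingFil

variable {R B C : Type*} [CommRing R] [Ring B] [Algebra R B] [Ring C] [Algebra R C]

/-- The filtered algebra `⋃ F d`. -/
def total (F : RingFil R B) : Subalgebra R B where
  carrier := {x | ∃ d, x ∈ F.F d}
  mul_mem' := by
    rintro x y ⟨i, hi⟩ ⟨j, hj⟩
    exact ⟨i + j, F.mul_mem hi hj⟩
  add_mem' := by
    rintro x y ⟨i, hi⟩ ⟨j, hj⟩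
    exact ⟨max i j, add_mem (F.mono (le_max_left _ _) hi) (F.mono (le_max_right _ _) hj)⟩
  algebraMap_mem' r := ⟨0, by
    rw [Algebra.algebraMap_eq_smul_one]; exact (F.F 0).smul_mem _ F.one_mem⟩

/-- The intersection of two filtrations, degree by degree. -/
def inf (F G : RingFil R B) : RingFil R B where
  F d := F.F d ⊓ G.F d
  mono _ _ h := inf_le_inf (F.mono h) (G.mono h)
  one_mem := ⟨F.one_mem, G.one_mem⟩
  mul_mem hx hy := ⟨F.mul_mem hx.1 hy.1, G.mul_mem hx.2 hy.2⟩

theorem total_inf (F G : RingFil R B) : (F.inf G).total = F.total ⊓ G.total := by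
  ext x
  constructor
  · rintro ⟨d, h1, h2⟩
    exact ⟨⟨d, h1⟩, ⟨d, h2⟩⟩
  · rintro ⟨⟨i, h1⟩, ⟨j, h2⟩⟩
    exact ⟨max i j, F.mono (le_max_left _ _) h1, G.mono (le_max_right _ _) h2⟩

/-- `F_{d-1}`, with the convention `F_{-1} = 0`. -/
def pred (F : RingFil R B) : ℕ → Submodule R B
  | 0 => ⊥
  | d + 1 => F.F d

theorem pred_mul_left (F : RingFil R B) {i j : ℕ} {x y : B} (hx : x ∈ F.F i)
    (hy : y ∈ F.pred j) : x * y ∈ F.pred (i + j) := by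
  rcases j with _ | j
  · have : y = 0 := by simpa [pred] using hy
    rw [this, mul_zero]; exact zero_mem _
  · exact F.mul_mem hx hy

theorem pred_mul_right (F : RingFil R B) {i j : ℕ} {x y : B} (hx : x ∈ F.pred i)
    (hy : y ∈ F.F j) : x * y ∈ F.pred (i + j) := by
  rcases i with _ | i
  · have : x = 0 := by simpa [pred] using hx
    rw [this, zero_mul]; exact zero_mem _
  · have := F.mul_mem hx hy
    rwa [show i + 1 + j = (i + j) + 1 by omega]

/-- The ring of formal sums `∑ a_d t^d` with `a_d ∈ F_d`. -/
def rees (F : RingFil R B) : Subring (Polynomial B) where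
  carrier := {P | ∀ d, P.coeff d ∈ F.F d}
  mul_mem' := by
    intro P Q hP hQ d
    rw [Polynomial.coeff_mul]
    refine sum_mem fun ij hij => ?_
    have : ij.1 + ij.2 = d := by simpa using hij
    rw [← this]
    exact F.mul_mem (hP _) (hQ _)
  one_mem' := by
    intro d
    rcases d with _ | d
    · simpa using F.one_mem
    · rw [Polynomial.coeff_one, if_neg (by omega)]; exact zero_mem _
  add_mem' := by
    intro P Q hP hQ d
    rw [Polynomial.coeff_add]
    exact add_mem (hP d) (hQ d)
  zero_mem' := by intro d; simp
  neg_mem' := by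
    intro P hP d
    rw [Polynomial.coeff_neg]
    exact neg_mem (hP d)

/-- The two-sided ideal of formal sums `∑ a_d t^d` with `a_d ∈ F_{d-1}`. -/
def reesIdeal (F : RingFil R B) : Ideal F.rees where
  carrier := {P | ∀ d, P.1.coeff d ∈ F.pred d}
  add_mem' := by
    intro P Q hP hQ d
    rw [Subring.coe_add, Polynomial.coeff_add]
    exact add_mem (hP d) (hQ d)
  zero_mem' := by intro d; simp
  smul_mem' := by
    intro P Q hQ d
    rw [smul_eq_mul, Subring.coe_mul, Polynomial.coeff_mul]
    refine sum_mem fun ij hij => ?_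
    have : ij.1 + ij.2 = d := by simpa using hij
    rw [← this]
    exact F.pred_mul_left (P.2 _) (hQ _)

instance (F : RingFil R B) : F.reesIdeal.IsTwoSided where
  mul_mem_of_left := by
    intro P Q hP d
    rw [Subring.coe_mul, Polynomial.coeff_mul]
    refine sum_mem fun ij hij => ?_
    have : ij.1 + ij.2 = d := by simpa using hij
    rw [← this]
    exact F.pred_mul_right (hP _) (Q.2 _)

/-- The associated graded ring `⨁ F_d / F_{d-1}`: formal sums `∑ a_d t^d` with `a_d ∈ F_d`, modulo
those with `a_d ∈ F_{d-1}` for all `d`. -/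
abbrev gr (F : RingFil R B) : Type _ := F.rees ⧸ F.reesIdeal

/-- The map on formal sums induced by a ring homomorphism compatible with filtrations. -/
def reesMap (F : RingFil R B) (G : RingFil R C) (g : B →+* C)
    (hg : ∀ d, ∀ x ∈ F.F d, g x ∈ G.F d) : F.rees →+* G.rees :=
  ((Polynomial.mapRingHom g).comp F.rees.subtype).codRestrict G.rees fun P d => by
    simpa using hg d _ (P.2 d)

/-- The homomorphism of associated graded rings induced by a ring homomorphism compatible with
filtrations. -/
def grMap (F : RingFil R B) (G : RingFil R C) (g : B →+* C)
    (hg : ∀ d, ∀ x ∈ F.F d, g x ∈ G.F d) : F.gr →+* G.gr :=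
  Ideal.quotientMap G.reesIdeal (reesMap F G g hg) fun P hP d => by
    have h : (reesMap F G g hg P).1.coeff d = g (P.1.coeff d) := Polynomial.coeff_map g d
    rw [h]
    have := hP d
    rcases d with _ | d
    · have h0 : P.1.coeff 0 = 0 := by simpa [pred] using this
      rw [h0, map_zero]; exact zero_mem _
    · exact hg d _ this

end RingFil

end Filtered

section LevelFiltrations

variable (p : ℕ) [hp : Fact p.Prime] (m : ℕ)
variable {A : Type*} [Ring A] [Algebra ℚ_[p] A] [Algebra ℤ_[p] A] [IsScalarTower ℤ_[p] ℚ_[p] A]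

/-- The element
`q_a! e^a / a! · q_b! (h choose b) · q_c! (k choose c) · q_d! f^d / d!` attached to `e, h, k, f`. -/
def pbw (e h k f : A) (a b c d : ℕ) : A :=
  (w p m a • e ^ a) * (w p m b • ff h b) * (w p m c • ff k c) * (w p m d • f ^ d)

/-- The `ℤ_p`-span of the elements `pbw` of degree at most `d`. -/
def pbwSpan (e h k f : A) (d : ℕ) : Submodule ℤ_[p] A :=
  Submodule.span ℤ_[p] {x | ∃ a b c l, a + b + c + l ≤ d ∧ x = pbw p m e h k f a b c l}

theorem pbwSpan_mono (e h k f : A) : Monotone (pbwSpan p m e h k f) := fun _ _ hd =>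
  Submodule.span_mono fun _ ⟨a, b, c, l, hl, e⟩ => ⟨a, b, c, l, hl.trans hd, e⟩

theorem mul_mem_pbwSpan {e h k f : A} {i j l d : ℕ} (hd : i + j + l ≤ d) {x y z : A}
    (hx : x ∈ powSpan p m e i) (hy : y ∈ ffSpan₂ p m h k j) (hz : z ∈ powSpan p m f l) :
    x * y * z ∈ pbwSpan p m e h k f d := by
  have h1 : ∀ l' ≤ l, x * y * (w p m l' • f ^ l') ∈ pbwSpan p m e h k f d := by
    intro l' hl'
    rw [mul_assoc]
    refine mul_mem_of_span (Y := {u | ∃ v ∈ ffSpan₂ p m h k j, u = v * (w p m l' • f ^ l')}) ?_ hx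
      (Submodule.subset_span ⟨y, hy, rfl⟩)
    rintro _ ⟨a, ha, rfl⟩ _ ⟨v, hv, rfl⟩
    rw [← mul_assoc]
    refine Submodule.span_induction (p := fun v _ =>
      w p m a • e ^ a * v * w p m l' • f ^ l' ∈ pbwSpan p m e h k f d) ?_ ?_ ?_ ?_ hv
    · rintro _ ⟨b, c, hbc, rfl⟩
      refine Submodule.subset_span ⟨a, b, c, l', by omega, ?_⟩
      simp only [pbw, mul_assoc]
    · simp
    · intro u v _ _ hu hv
      rw [mul_add, add_mul]; exact add_mem hu hv
    · intro s u _ hu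
      rw [mul_smul_comm s, smul_mul_assoc s]; exact Submodule.smul_mem _ _ hu
  refine mul_mem_of_span (X := {x * y}) ?_ (Submodule.mem_span_singleton_self _) hz
  rintro _ rfl _ ⟨l', hl', rfl⟩
  exact h1 l' hl'

variable {e h k f : A}

theorem pbw_right (r : GL2Rel e h k f) (i a : ℕ) {y : A} (hy : y ∈ ffSpan₂ p m h k i) :
    ∃ y' ∈ ffSpan₂ p m h k i, y * e ^ a = e ^ a * y' := by
  have h1 : ∀ a : ℕ, h * e ^ a = e ^ a * (h + ((a : ℤ) : A)) := by
    intro a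
    induction a with
    | zero => simp
    | succ a ih =>
      rw [pow_succ, ← mul_assoc, ih, mul_assoc, add_mul, r.he, (Int.cast_commute _ e).eq,
        ← mul_add, ← mul_assoc]
      congr 1
      push_cast
      abel
  have h2 : ∀ a : ℕ, k * e ^ a = e ^ a * (k + ((-a : ℤ) : A)) := by
    intro a
    induction a with
    | zero => simp
    | succ a ih =>
      rw [pow_succ, ← mul_assoc, ih, mul_assoc, add_mul, r.ke, (Int.cast_commute _ e).eq,
        ← mul_add, ← mul_assoc]
      congr 1
      push_cast
      abel
  refine Submodule.span_induction (p := fun y _ =>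
    ∃ y' ∈ ffSpan₂ p m h k i, y * e ^ a = e ^ a * y') ?_ ?_ ?_ ?_ hy
  · rintro _ ⟨b, c, hbc, rfl⟩
    refine ⟨_, ffSpan₂_shift p m h k a (-a) i (Submodule.subset_span ⟨b, c, hbc, rfl⟩), ?_⟩
    simp only [mul_assoc, smul_mul_assoc, mul_smul_comm]
    rw [ff_comm _ (h2 a), ← mul_assoc, ff_comm _ (h1 a), mul_assoc]
  · exact ⟨0, zero_mem _, by simp⟩
  · rintro u v _ _ ⟨u', hu, eu⟩ ⟨v', hv, ev⟩
    exact ⟨u' + v', add_mem hu hv, by rw [add_mul, mul_add, eu, ev]⟩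
  · rintro s u _ ⟨u', hu, eu⟩
    exact ⟨s • u', Submodule.smul_mem _ _ hu, by rw [smul_mul_assoc, mul_smul_comm, eu]⟩

theorem pbw_left (r : GL2Rel e h k f) (i a : ℕ) {y : A} (hy : y ∈ ffSpan₂ p m h k i) :
    ∃ y' ∈ ffSpan₂ p m h k i, f ^ a * y = y' * f ^ a := by
  have h1 : ∀ a : ℕ, f ^ a * h = (h + ((a : ℤ) : A)) * f ^ a := by
    intro a
    induction a with
    | zero => simp
    | succ a ih =>
      rw [pow_succ', mul_assoc, ih, ← mul_assoc, mul_add, r.fh, ← (Int.cast_commute _ f).eq,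
        ← add_mul, mul_assoc]
      congr 1
      push_cast
      abel
  have h2 : ∀ a : ℕ, f ^ a * k = (k + ((-a : ℤ) : A)) * f ^ a := by
    intro a
    induction a with
    | zero => simp
    | succ a ih =>
      rw [pow_succ', mul_assoc, ih, ← mul_assoc, mul_add, r.fk, ← (Int.cast_commute _ f).eq,
        ← add_mul, mul_assoc]
      congr 1
      push_cast
      abel
  refine Submodule.span_induction (p := fun y _ =>
    ∃ y' ∈ ffSpan₂ p m h k i, f ^ a * y = y' * f ^ a) ?_ ?_ ?_ ?_ hy
  · rintro _ ⟨b, c, hbc, rfl⟩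
    refine ⟨_, ffSpan₂_shift p m h k a (-a) i (Submodule.subset_span ⟨b, c, hbc, rfl⟩), ?_⟩
    simp only [smul_mul_assoc, mul_smul_comm]
    rw [← mul_assoc, ff_comm' _ (h1 a), mul_assoc, ff_comm' _ (h2 a), mul_assoc]
  · exact ⟨0, zero_mem _, by simp⟩
  · rintro u v _ _ ⟨u', hu, eu⟩ ⟨v', hv, ev⟩
    exact ⟨u' + v', add_mem hu hv, by rw [add_mul, mul_add, eu, ev]⟩
  · rintro s u _ ⟨u', hu, eu⟩
    exact ⟨s • u', Submodule.smul_mem _ _ hu, by rw [smul_mul_assoc, mul_smul_comm, eu]⟩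

theorem pbwSpan_mul (r : GL2Rel e h k f) {i j : ℕ} {x y : A} (hx : x ∈ pbwSpan p m e h k f i)
    (hy : y ∈ pbwSpan p m e h k f j) : x * y ∈ pbwSpan p m e h k f (i + j) := by
  refine mul_mem_of_span ?_ hx hy
  rintro _ ⟨a, b, c, l, hi, rfl⟩ _ ⟨a', b', c', l', hj, rfl⟩
  have hy₁ : (w p m b • ff h b) * (w p m c • ff k c) ∈ ffSpan₂ p m h k (b + c) :=
    Submodule.subset_span ⟨b, c, le_rfl, rfl⟩
  have hy₂ : (w p m b' • ff h b') * (w p m c' • ff k c') ∈ ffSpan₂ p m h k (b' + c') :=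
    Submodule.subset_span ⟨b', c', le_rfl, rfl⟩
  rw [pbw, pbw, mul_assoc (w p m a • e ^ a), mul_assoc (w p m a' • e ^ a')]
  set y₁ := (w p m b • ff h b) * (w p m c • ff k c)
  set y₂ := (w p m b' • ff h b') * (w p m c' • ff k c')
  have e1 : w p m a • e ^ a * y₁ * w p m l • f ^ l * (w p m a' • e ^ a' * y₂ * w p m l' • f ^ l')
      = (w p m l * w p m a') • (w p m a • e ^ a * y₁ * (f ^ l * e ^ a') * y₂ *
        w p m l' • f ^ l') := by
    simp only [smul_mul_assoc, mul_smul_comm, smul_smul, mul_assoc]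
    congr 1; ring
  rw [e1, r.kostant, Finset.mul_sum, Finset.sum_mul, Finset.sum_mul, Finset.smul_sum]
  refine sum_mem fun t ht => ?_
  have ht' : t ≤ a' := by simpa [Nat.lt_succ_iff] using ht
  by_cases htl : l < t
  · rw [Nat.descFactorial_of_lt htl]; simp
  have htl : t ≤ l := not_lt.1 htl
  have hy₃ := ff_neg_add_mem p m r.hk (2 * t - a' - l) t
  set y₃ := ff (-h + k + ((2 * t - a' - l : ℤ) : A)) t
  obtain ⟨z₁, hz₁, ez₁⟩ := pbw_right p m r (b + c) (a' - t) hy₁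
  obtain ⟨z₂, hz₂, ez₂⟩ := pbw_left p m r (b' + c') (l - t) hy₂
  have e2 : (w p m l * w p m a') • (w p m a • e ^ a * y₁ * (a'.choose t * l.descFactorial t) •
      (e ^ (a' - t) * y₃ * f ^ (l - t)) * y₂ * w p m l' • f ^ l') =
      ((((q p m a')! * (q p m l)! : ℕ) : ℚ_[p]) /
        (((q p m (a' - t))! * (q p m t)! * (q p m (l - t))! : ℕ) : ℚ_[p])) •
      ((w p m a • e ^ a * w p m (a' - t) • e ^ (a' - t)) * (z₁ * (w p m t • y₃) * z₂) *
        (w p m (l - t) • f ^ (l - t) * w p m l' • f ^ l')) := by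
    have e3 : y₁ * (e ^ (a' - t) * (y₃ * (f ^ (l - t) * (y₂ * f ^ l')))) =
        e ^ (a' - t) * (z₁ * (y₃ * (z₂ * (f ^ (l - t) * f ^ l')))) := by
      rw [← mul_assoc, ez₁, ← mul_assoc (f ^ (l - t)) y₂, ez₂]
      simp only [mul_assoc]
    rw [← Nat.cast_smul_eq_nsmul ℚ_[p]]
    simp only [smul_mul_assoc, mul_smul_comm, smul_smul, mul_assoc]
    rw [e3]
    congr 1
    have h1 := fact_ne (p := p) (a' - t)
    have h2 := fact_ne (p := p) t
    have h3 := fact_ne (p := p) (l - t)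
    have h4 := fact_ne (p := p) (q p m (a' - t))
    have h5 := fact_ne (p := p) (q p m t)
    have h6 := fact_ne (p := p) (q p m (l - t))
    have h7 := fact_ne (p := p) a'
    have h8 := fact_ne (p := p) l
    have h9 : (a'.choose t : ℚ_[p]) = (a' ! : ℚ_[p]) / ((t ! : ℚ_[p]) * ((a' - t)! : ℚ_[p])) :=
      Nat.cast_choose _ ht'
    have h10 : (l.descFactorial t : ℚ_[p]) = (l ! : ℚ_[p]) / ((l - t)! : ℚ_[p]) := by
      rw [eq_div_iff h3, mul_comm]
      exact_mod_cast Nat.factorial_mul_descFactorial htl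
    push_cast
    rw [h9, h10]
    simp only [w]
    field_simp
  rw [e2]
  refine smul_mem_of_norm_le (mul_mem_pbwSpan p m (i := a + (a' - t)) (j := b + c + t + (b' + c'))
    (l := l - t + l') (by omega) ?_ ?_ ?_) ?_
  · exact powSpan_mul p m (pow_mem_powSpan p m e le_rfl) (pow_mem_powSpan p m e le_rfl)
  · exact ffSpan₂_mul p m r.hk (ffSpan₂_mul p m r.hk hz₁ hy₃) hz₂
  · exact powSpan_mul p m (pow_mem_powSpan p m f le_rfl) (pow_mem_powSpan p m f le_rfl)
  · refine norm_div_le_of_dvd (mul_dvd_mul ?_ (Nat.factorial_dvd_factorial (q_mono p m (by omega))))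
    have := q_add_le p m (a' - t) t
    rw [Nat.sub_add_cancel ht'] at this
    exact (Nat.factorial_mul_factorial_dvd_factorial_add _ _).trans
      (Nat.factorial_dvd_factorial this)

/-- The filtered algebra spanned by the elements `pbw`. -/
def pbwFil (r : GL2Rel e h k f) : RingFil ℤ_[p] A where
  F := pbwSpan p m e h k f
  mono := pbwSpan_mono p m e h k f
  one_mem := Submodule.subset_span ⟨0, 0, 0, 0, le_rfl, by simp [pbw, ff_zero, w_zero]⟩
  mul_mem := pbwSpan_mul p m r

end LevelFiltrations

section Chart

variable (p : ℕ) [hp : Fact p.Prime] (m : ℕ)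
variable {A : Type*} [Ring A] [Algebra ℚ_[p] A] [Algebra ℤ_[p] A] [IsScalarTower ℤ_[p] ℚ_[p] A]

/-- For a coordinate `t` with derivation `δ = d/dt`: the `ℤ_p`-module of the finite sums
`∑_{a ≤ d} γ_a · (q_a! / a!) δ^a` with `γ_a ∈ ℤ_p[t]`. -/
def chartSpan (t δ : A) (d : ℕ) : Submodule ℤ_[p] A :=
  Submodule.span ℤ_[p] {x | ∃ i a, a ≤ d ∧ x = t ^ i * (w p m a • δ ^ a)}

theorem chart_mem (t δ : A) {i a d : ℕ} (h : a ≤ d) :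
    t ^ i * (w p m a • δ ^ a) ∈ chartSpan p m t δ d := Submodule.subset_span ⟨i, a, h, rfl⟩

theorem chartSpan_mono (t δ : A) : Monotone (chartSpan p m t δ) := fun _ _ hd =>
  Submodule.span_mono fun _ ⟨i, a, h, e⟩ => ⟨i, a, h.trans hd, e⟩

variable {t δ : A}

theorem pow_mul_coord (ht : δ * t = t * δ + 1) (a : ℕ) : δ ^ (a + 1) * t = t * δ ^ (a + 1) + (a + 1 : ℕ) • δ ^ a := by
  induction a with
  | zero => simp [ht]
  | succ a ih =>
    rw [pow_succ', mul_assoc, ih, mul_add, ← mul_assoc, ht, mul_smul_comm, ← pow_succ', add_mul,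
      one_mul, mul_assoc, ← pow_succ', add_assoc, succ_nsmul' _ (a + 1)]

theorem chartSpan_mul_coord (ht : δ * t = t * δ + 1) {d : ℕ} {x : A} (hx : x ∈ chartSpan p m t δ d) (j : ℕ) :
    x * t ^ j ∈ chartSpan p m t δ d := by
  induction j with
  | zero => simpa using hx
  | succ j ih =>
    rw [pow_succ, ← mul_assoc]
    refine mul_mem_of_span (Y := {t}) ?_ ih (Submodule.mem_span_singleton_self _)
    rintro _ ⟨i, a, ha, rfl⟩ y hy
    rw [Set.mem_singleton_iff.1 hy]
    rcases a with _ | a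
    · have := chart_mem p m t δ (i := i + 1) (Nat.zero_le d)
      simpa [w_zero, pow_succ] using this
    · have e : t ^ i * w p m (a + 1) • δ ^ (a + 1) * t = t ^ (i + 1) * w p m (a + 1) • δ ^ (a + 1) +
          (w p m (a + 1) * ((a + 1 : ℕ) : ℚ_[p]) / w p m a) • (t ^ i * w p m a • δ ^ a) := by
        rw [mul_assoc, smul_mul_assoc, pow_mul_coord ht, ← Nat.cast_smul_eq_nsmul ℚ_[p],
          mul_smul_comm (w p m a), smul_smul _ (w p m a), div_mul_cancel₀ _ (w_ne p m _),
          pow_succ t]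
        simp only [mul_smul_comm, smul_add, mul_add, smul_smul, mul_assoc]
      rw [e]
      exact add_mem (chart_mem p m t δ ha)
        (smul_mem_of_norm_le (chart_mem p m t δ (by omega)) (w_succ_ratio p m a))

theorem chartSpan_mul (ht : δ * t = t * δ + 1) {i j : ℕ} {x y : A} (hx : x ∈ chartSpan p m t δ i)
    (hy : y ∈ chartSpan p m t δ j) : x * y ∈ chartSpan p m t δ (i + j) := by
  refine mul_mem_of_span (X := (chartSpan p m t δ i : Set A)) ?_ (by simpa using hx) hy
  rintro x hx _ ⟨l, b, hb, rfl⟩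
  rw [← mul_assoc]
  refine mul_mem_of_span (Y := {w p m b • δ ^ b}) ?_ (chartSpan_mul_coord p m ht hx l)
    (Submodule.mem_span_singleton_self _)
  rintro _ ⟨k, a, ha, rfl⟩ _ rfl
  rw [mul_assoc, smul_mul_smul_comm, ← pow_add, smul_smul_div, mul_smul_comm]
  exact smul_mem_of_norm_le (chart_mem p m t δ (by omega)) (norm_w_mul_le p m a b)

/-- The ring of differential operators of level `m` on a chart with coordinate `t` and derivation
`δ = d/dt`, filtered by the order. -/
def chartFil (ht : δ * t = t * δ + 1) : RingFil ℤ_[p] A where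
  F := chartSpan p m t δ
  mono := chartSpan_mono p m t δ
  one_mem := by
    have := chart_mem p m t δ (i := 0) (le_refl 0)
    simpa [w_zero] using this
  mul_mem := chartSpan_mul p m ht

theorem ff_euler (ht : δ * t = t * δ + 1) (n : ℕ) : ff (t * δ) n = t ^ n * δ ^ n := by
  induction n with
  | zero => simp [ff_zero]
  | succ n ih =>
    have h1 : δ ^ n * t = t * δ ^ n + n • δ ^ n * (0 : A) + (n : A) * δ ^ (n - 1) := by
      rcases n with _ | n
      · simp
      · rw [pow_mul_coord ht]; simp
    have h2 : (n : A) * δ ^ (n - 1) * δ = (n : A) * δ ^ n := by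
      rcases n with _ | n
      · simp
      · rw [mul_assoc, Nat.add_sub_cancel, ← pow_succ]
    rw [ff_succ, ih, mul_sub, mul_assoc, ← mul_assoc (δ ^ n), h1, mul_zero, add_zero, add_mul, h2,
      mul_add, ← (Nat.cast_commute n (t ^ n * δ ^ n)).eq, ← mul_assoc (t ^ n) (n : A),
      ← (Nat.cast_commute n (t ^ n)).eq, mul_assoc (n : A), add_sub_cancel_right, mul_assoc t,
      ← pow_succ, ← mul_assoc, ← pow_succ]

theorem ffSpan_euler_le (ht : δ * t = t * δ + 1) (d : ℕ) : ffSpan p m (t * δ) d ≤ chartSpan p m t δ d := by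
  rw [ffSpan, Submodule.span_le]
  rintro _ ⟨b, hb, rfl⟩
  rw [ff_euler ht, ← mul_smul_comm]
  exact chart_mem p m t δ hb

theorem sq_pow (ht : δ * t = t * δ + 1) (n : ℕ) : (t * t * δ) ^ n = t ^ n * ff (t * δ + n - 1) n := by
  have h1 : ∀ n : ℕ, (t * δ) * t ^ n = t ^ n * (t * δ + n) := by
    intro n
    induction n with
    | zero => simp
    | succ n ih =>
      have h2 : (t * δ + n) * t = t * (t * δ + (n + 1 : ℕ)) := by
        rw [add_mul, mul_assoc, ht, (Nat.cast_commute n t).eq, ← mul_add]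
        congr 1
        push_cast
        abel
      rw [pow_succ, ← mul_assoc, ih, mul_assoc, h2, mul_assoc]
  induction n with
  | zero => simp [ff_zero]
  | succ n ih =>
    have e : t * δ + ((n + 1 : ℕ) : A) - 1 = t * δ + n := by push_cast; abel
    rw [pow_succ', ih, e, ff_succ_left, mul_assoc t, mul_assoc t, ← mul_assoc (t * δ), h1, pow_succ',
      mul_assoc, mul_assoc]

theorem smul_sq_pow_mem (ht : δ * t = t * δ + 1) (n d : ℕ) (h : n ≤ d) :
    w p m n • (-(t * t * δ)) ^ n ∈ chartSpan p m t δ d := by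
  have h1 : w p m n • (t * t * δ) ^ n ∈ chartSpan p m t δ d := by
    have h2 : w p m n • ff (t * δ + n - 1) n ∈ ffSpan p m (t * δ) d := by
      rw [← ffSpan_add_int p m (t * δ) (n - 1)]
      have e : t * δ + n - 1 = t * δ + ((n - 1 : ℤ) : A) := by push_cast; abel
      rw [e]
      exact ff_mem_ffSpan p m _ h
    have h3 := chartSpan_mul p m ht (i := 0) (j := d) (x := t ^ n)
      (by simpa [w_zero] using chart_mem p m t δ (i := n) (le_refl 0)) (ffSpan_euler_le p m ht d h2)
    rw [zero_add, mul_smul_comm, ← sq_pow ht] at h3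
    exact h3
  rcases neg_one_pow_eq_or A n with e | e <;> rw [neg_pow, e]
  · simpa using h1
  · simpa using neg_mem h1

theorem smul_pow_mem (_ht : δ * t = t * δ + 1) (n d : ℕ) (h : n ≤ d) : w p m n • δ ^ n ∈ chartSpan p m t δ d := by
  simpa using chart_mem p m t δ (i := 0) h

theorem smul_ff_mem (ht : δ * t = t * δ + 1) (n d : ℕ) (h : n ≤ d) : w p m n • ff (t * δ) n ∈ chartSpan p m t δ d :=
  ffSpan_euler_le p m ht d (ff_mem_ffSpan p m _ h)

theorem smul_ff_neg_mem (ht : δ * t = t * δ + 1) (n d : ℕ) (h : n ≤ d) : w p m n • ff (-(t * δ)) n ∈ chartSpan p m t δ d :=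
  ffSpan_euler_le p m ht d (ffSpan_neg_le p m _ d (ff_mem_ffSpan p m _ h))

end Chart

section Operators

variable (p : ℕ) [hp : Fact p.Prime] (m : ℕ)

/-- `ℚ_p[x, x⁻¹]`, the functions on the generic fibre of `U_x ∩ U_y`, where `x = T 1`. -/
abbrev Lau : Type := LaurentPolynomial ℚ_[p]

/-- `ℚ_p`-linear operators on `ℚ_p[x, x⁻¹]`. -/
abbrev Op : Type := Module.End ℚ_[p] (Lau p)

/-- The monomial basis `(x^n)`, `n ∈ ℤ`, of `ℚ_p[x, x⁻¹]`. -/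
def monoBasis : Module.Basis ℤ ℚ_[p] (Lau p) := AddMonoidAlgebra.basis ℤ ℚ_[p]

theorem monoBasis_apply (n : ℤ) : monoBasis p n = LaurentPolynomial.T n := rfl

variable {p} in
theorem op_ext {P Q : Op p} (h : ∀ n : ℤ, P (LaurentPolynomial.T n) = Q (LaurentPolynomial.T n)) :
    P = Q :=
  (monoBasis p).ext fun n => by rw [monoBasis_apply]; exact h n

/-- Multiplication by `x`. -/
def xOp : Op p := LinearMap.mulLeft ℚ_[p] (LaurentPolynomial.T 1)

/-- Multiplication by `y = x⁻¹`. -/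
def yOp : Op p := LinearMap.mulLeft ℚ_[p] (LaurentPolynomial.T (-1))

/-- The derivation `∂_x = d/dx`, with `∂_x (x^n) = n x^{n-1}`. -/
def dx : Op p := (monoBasis p).constr ℚ_[p] fun n : ℤ => (n : ℚ_[p]) • LaurentPolynomial.T (n - 1)

/-- The derivation `∂_y = d/dy = -x² ∂_x`. -/
def dy : Op p := -(xOp p * xOp p * dx p)

theorem xOp_T (n : ℤ) : xOp p (LaurentPolynomial.T n) = LaurentPolynomial.T (n + 1) := by
  rw [add_comm, LaurentPolynomial.T_add]; rfl

theorem yOp_T (n : ℤ) : yOp p (LaurentPolynomial.T n) = LaurentPolynomial.T (n - 1) := by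
  rw [← neg_add_eq_sub, LaurentPolynomial.T_add]; rfl

theorem dx_T (n : ℤ) :
    dx p (LaurentPolynomial.T n) = (n : ℚ_[p]) • LaurentPolynomial.T (n - 1) := by
  rw [dx, ← monoBasis_apply, Module.Basis.constr_basis]

theorem dy_T (n : ℤ) :
    dy p (LaurentPolynomial.T n) = (-n : ℚ_[p]) • LaurentPolynomial.T (n + 1) := by
  simp only [dy, LinearMap.neg_apply, Module.End.mul_apply, dx_T, map_smul, xOp_T, neg_smul]
  congr 3
  ring

theorem euler_T (n : ℤ) :
    (xOp p * dx p) (LaurentPolynomial.T n) = (n : ℚ_[p]) • LaurentPolynomial.T n := by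
  simp only [Module.End.mul_apply, dx_T, map_smul, xOp_T]
  congr 2
  ring

theorem dx_mul_xOp : dx p * xOp p = xOp p * dx p + 1 := op_ext fun n => by
  rw [LinearMap.add_apply, euler_T]
  simp only [Module.End.mul_apply, dx_T, xOp_T, Module.End.one_apply, add_sub_cancel_right]
  push_cast
  module

theorem yOp_mul_dy : yOp p * dy p = -(xOp p * dx p) := op_ext fun n => by
  rw [LinearMap.neg_apply, euler_T]
  simp only [Module.End.mul_apply, dy_T, map_smul, yOp_T, add_sub_cancel_right]
  module

theorem dy_mul_yOp : dy p * yOp p = yOp p * dy p + 1 := op_ext fun n => by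
  rw [yOp_mul_dy, LinearMap.add_apply, LinearMap.neg_apply, euler_T]
  simp only [Module.End.mul_apply, dy_T, yOp_T, Module.End.one_apply, sub_add_cancel]
  push_cast
  module

theorem dx_eq : dx p = -(yOp p * yOp p * dy p) := op_ext fun n => by
  simp only [LinearMap.neg_apply, Module.End.mul_apply, dy_T, map_smul, yOp_T, dx_T]
  rw [show n + 1 - 1 - 1 = n - 1 by ring]
  module

/-- Sections of `𝒟^{(m)}` over `U_x = Spec ℤ_p[x]`: finite sums `∑ γ_ν (q_ν! / ν!) ∂_x^ν` with
`γ_ν ∈ ℤ_p[x]`, filtered by the order `ν ≤ d`. Since `𝒟^{(m)}` is `p`-torsion free and restriction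
to `U_x ∩ U_y` is injective, they are identified with operators on `ℚ_p[x, x⁻¹]`. -/
def DUx : RingFil ℤ_[p] (Op p) := chartFil p m (dx_mul_xOp p)

/-- Sections of `𝒟^{(m)}` over `U_y = Spec ℤ_p[y]`, `y = x⁻¹`: finite sums
`∑ γ_ν (q_ν! / ν!) ∂_y^ν` with `γ_ν ∈ ℤ_p[y]`, filtered by the order. -/
def DUy : RingFil ℤ_[p] (Op p) := chartFil p m (dy_mul_yOp p)

/-- The filtration of `H⁰(ℙ¹, 𝒟^{(m)})` by the submodules `H⁰(ℙ¹, 𝒟^{(m)}_d)`: since `ℙ¹` is glued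
from `U_x` and `U_y`, a global section is a section over `U_x` and a section over `U_y` that agree
on `U_x ∩ U_y`. -/
def H0DFil : RingFil ℤ_[p] (Op p) := (DUx p m).inf (DUy p m)

/-- The ring `H⁰(ℙ¹, 𝒟^{(m)})` of global sections. -/
abbrev H0D : Subalgebra ℤ_[p] (Op p) := (DUx p m).total ⊓ (DUy p m).total

theorem mem_H0D_iff {P : Op p} : P ∈ H0D p m ↔ ∃ d, P ∈ (H0DFil p m).F d := by
  rw [H0D, ← RingFil.total_inf]
  rfl

end Operators

section Envelope

attribute [local instance] LieRing.ofAssociativeRing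

variable (p : ℕ) [hp : Fact p.Prime] (m : ℕ)

/-- The universal enveloping algebra `U(𝔤)` of `𝔤 = 𝔤𝔩₂(ℚ_p)`. -/
abbrev Ug : Type := UniversalEnvelopingAlgebra ℚ_[p] (Matrix (Fin 2) (Fin 2) ℚ_[p])

/-- The universal enveloping algebra `U(𝔤_{ℤ_p})` of `𝔤_{ℤ_p} = 𝔤𝔩₂(ℤ_p)` over `ℤ_p`. -/
abbrev UgZ : Type := UniversalEnvelopingAlgebra ℤ_[p] (Matrix (Fin 2) (Fin 2) ℤ_[p])

instance : Algebra ℤ_[p] (Ug p) := Algebra.compHom (Ug p) (algebraMap ℤ_[p] ℚ_[p])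

instance : IsScalarTower ℤ_[p] ℚ_[p] (Ug p) := IsScalarTower.of_algebraMap_eq fun _ => rfl

/-- The element `e` of `U(𝔤)`. -/
def eU : Ug p := UniversalEnvelopingAlgebra.ι ℚ_[p] !![0, 1; 0, 0]
/-- The element `h₁` of `U(𝔤)`. -/
def h₁U : Ug p := UniversalEnvelopingAlgebra.ι ℚ_[p] !![1, 0; 0, 0]
/-- The element `h₂` of `U(𝔤)`. -/
def h₂U : Ug p := UniversalEnvelopingAlgebra.ι ℚ_[p] !![0, 0; 0, 1]
/-- The element `f` of `U(𝔤)`. -/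
def fU : Ug p := UniversalEnvelopingAlgebra.ι ℚ_[p] !![0, 0; 1, 0]

theorem ι_comm (x y : Matrix (Fin 2) (Fin 2) ℚ_[p]) :
    UniversalEnvelopingAlgebra.ι ℚ_[p] x * UniversalEnvelopingAlgebra.ι ℚ_[p] y =
      UniversalEnvelopingAlgebra.ι ℚ_[p] y * UniversalEnvelopingAlgebra.ι ℚ_[p] x +
      UniversalEnvelopingAlgebra.ι ℚ_[p] (x * y - y * x) := by
  have h : UniversalEnvelopingAlgebra.ι ℚ_[p] ⁅x, y⁆ = _ :=
    LieHom.map_lie (UniversalEnvelopingAlgebra.ι ℚ_[p]) x y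
  rw [LieRing.of_associative_ring_bracket, LieRing.of_associative_ring_bracket] at h
  rw [h]
  abel

theorem ι_neg (x : Matrix (Fin 2) (Fin 2) ℚ_[p]) :
    UniversalEnvelopingAlgebra.ι ℚ_[p] (-x) = -UniversalEnvelopingAlgebra.ι ℚ_[p] x :=
  (UniversalEnvelopingAlgebra.ι ℚ_[p]).toLinearMap.map_neg x

theorem ι_sub (x y : Matrix (Fin 2) (Fin 2) ℚ_[p]) :
    UniversalEnvelopingAlgebra.ι ℚ_[p] (x - y) =
      UniversalEnvelopingAlgebra.ι ℚ_[p] x - UniversalEnvelopingAlgebra.ι ℚ_[p] y :=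
  (UniversalEnvelopingAlgebra.ι ℚ_[p]).toLinearMap.map_sub x y

theorem ι_zero : UniversalEnvelopingAlgebra.ι ℚ_[p] (0 : Matrix (Fin 2) (Fin 2) ℚ_[p]) = 0 :=
  (UniversalEnvelopingAlgebra.ι ℚ_[p]).toLinearMap.map_zero

theorem ug_rel : GL2Rel (eU p) (h₁U p) (h₂U p) (fU p) where
  he := by
    rw [mul_add, mul_one, h₁U, eU, ι_comm]
    congr 2
    ext i j
    fin_cases i <;> fin_cases j <;> simp
  ke := by
    rw [mul_sub, mul_one, h₂U, eU, ι_comm, sub_eq_add_neg _ (UniversalEnvelopingAlgebra.ι ℚ_[p] _), ← ι_neg]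
    congr 2
    ext i j
    fin_cases i <;> fin_cases j <;> simp
  fh := by
    rw [add_mul, one_mul, h₁U, fU, ι_comm]
    congr 2
    ext i j
    fin_cases i <;> fin_cases j <;> simp
  fk := by
    rw [sub_mul, one_mul, h₂U, fU, ι_comm, sub_eq_add_neg _ (UniversalEnvelopingAlgebra.ι ℚ_[p] _), ← ι_neg]
    congr 2
    ext i j
    fin_cases i <;> fin_cases j <;> simp
  fe := by
    rw [h₁U, h₂U, fU, eU, ι_comm, sub_eq_add_neg _ (_ - _), ← ι_sub, ← ι_neg]
    congr 2
    ext i j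
    fin_cases i <;> fin_cases j <;> simp
  hk := by
    rw [Commute, SemiconjBy, h₁U, h₂U, ι_comm]
    have h : (!![1, 0; 0, 0] * !![0, 0; 0, 1] - !![0, 0; 0, 1] * !![1, 0; 0, 0] :
        Matrix (Fin 2) (Fin 2) ℚ_[p]) = 0 := by
      ext i j
      fin_cases i <;> fin_cases j <;> simp
    rw [h, ι_zero, add_zero]

/-- The filtration of `U(𝔤_{ℤ_p})^{(m)}`: degree `≤ d` is the `ℤ_p`-span in `U(𝔤)` of the elements
`q_a! e^a / a! · q_b! (h₁ choose b) · q_c! (h₂ choose c) · q_l! f^l / l!`, `a + b + c + l ≤ d`. -/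
def UmFil : RingFil ℤ_[p] (Ug p) := pbwFil p m (ug_rel p)

/-- The ring `U(𝔤_{ℤ_p})^{(m)}`. -/
abbrev Um : Subalgebra ℤ_[p] (Ug p) := (UmFil p m).total

theorem deriv_comm_neg_euler {A : Type*} [Ring A] {t δ : A} (ht : δ * t = t * δ + 1) :
    δ * (-(t * δ)) = -(t * δ) * δ - δ := by
  rw [mul_neg, neg_mul, ← mul_assoc, ht, add_mul, one_mul]
  abel

theorem dx_comm_euler : dx p * (xOp p * dx p) = xOp p * dx p * dx p + dx p := by
  rw [← mul_assoc, dx_mul_xOp, add_mul, one_mul]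

theorem dy_comm_euler : dy p * (xOp p * dx p) = xOp p * dx p * dy p - dy p := by
  have h : xOp p * dx p = -(yOp p * dy p) := by rw [yOp_mul_dy, neg_neg]
  rw [h]
  exact deriv_comm_neg_euler (dy_mul_yOp p)

theorem dx_comm_dy : dx p * dy p = dy p * dx p - (2 : ℚ_[p]) • (xOp p * dx p) :=
  op_ext fun n => by
    rw [LinearMap.sub_apply, LinearMap.smul_apply, euler_T]
    simp only [Module.End.mul_apply, dy_T, dx_T, map_smul, add_sub_cancel_right, sub_add_cancel]
    push_cast
    module

/-- The Lie algebra homomorphism `e ↦ ∂_x`, `h₁ ↦ -x ∂_x`, `h₂ ↦ x ∂_x`, `f ↦ ∂_y` given by the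
right action of `GL₂` on `ℙ¹`. -/
def lieAct : Matrix (Fin 2) (Fin 2) ℚ_[p] →ₗ⁅ℚ_[p]⁆ Op p where
  toFun X := X 0 1 • dx p - X 0 0 • (xOp p * dx p) + X 1 1 • (xOp p * dx p) + X 1 0 • dy p
  map_add' X Y := by
    simp only [Matrix.add_apply]
    module
  map_smul' c X := by
    simp only [Matrix.smul_apply, smul_eq_mul, RingHom.id_apply]
    module
  map_lie' := by
    intro X Y
    rw [LieRing.of_associative_ring_bracket, LieRing.of_associative_ring_bracket]
    simp only [Matrix.sub_apply, Matrix.mul_apply, Fin.sum_univ_two]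
    have h1 := dx_comm_euler p
    have h2 := dy_comm_euler p
    have h3 := dx_comm_dy p
    generalize xOp p * dx p = E at *
    generalize dx p = D at *
    generalize dy p = F at *
    simp only [mul_add, mul_sub, add_mul, sub_mul, smul_mul_assoc, mul_smul_comm, h1, h2, h3]
    module

/-- The induced homomorphism from `U(𝔤)` to differential operators. -/
def xiQ : Ug p →ₐ[ℚ_[p]] Op p := UniversalEnvelopingAlgebra.lift ℚ_[p] (lieAct p)

theorem xiQ_ι (X : Matrix (Fin 2) (Fin 2) ℚ_[p]) :
    xiQ p (UniversalEnvelopingAlgebra.ι ℚ_[p] X) = lieAct p X :=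
  UniversalEnvelopingAlgebra.lift_ι_apply _ _ _

theorem xiQ_e : xiQ p (eU p) = dx p := by
  rw [eU, xiQ_ι]; simp [lieAct]

theorem xiQ_h₁ : xiQ p (h₁U p) = -(xOp p * dx p) := by
  rw [h₁U, xiQ_ι]; simp [lieAct]

theorem xiQ_h₂ : xiQ p (h₂U p) = xOp p * dx p := by
  rw [h₂U, xiQ_ι]; simp [lieAct]

theorem xiQ_f : xiQ p (fU p) = dy p := by
  rw [fU, xiQ_ι]; simp [lieAct]

theorem xiQ_ff (h : Ug p) (n : ℕ) : xiQ p (ff h n) = ff (xiQ p h) n := by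
  induction n with
  | zero => simp [ff_zero]
  | succ n ih => rw [ff_succ, map_mul, ih, map_sub, map_natCast, ff_succ]

theorem xiQ_smulZ (c : ℤ_[p]) (u : Ug p) : xiQ p (c • u) = c • xiQ p u := by
  rw [← algebraMap_smul ℚ_[p] c u, map_smul, algebraMap_smul]

theorem xiQ_mem (d : ℕ) (u : Ug p) (hu : u ∈ (UmFil p m).F d) : xiQ p u ∈ (H0DFil p m).F d := by
  refine Submodule.span_induction (p := fun u _ => xiQ p u ∈ (H0DFil p m).F d) ?_ ?_ ?_ ?_ hu
  · rintro _ ⟨a, b, c, l, hl, rfl⟩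
    refine (H0DFil p m).mono hl ?_
    rw [pbw, map_mul, map_mul, map_mul, map_smul, map_smul, map_smul, map_smul, map_pow, map_pow,
      xiQ_ff, xiQ_ff, xiQ_e, xiQ_f, xiQ_h₁, xiQ_h₂]
    constructor
    · exact (DUx p m).mul_mem ((DUx p m).mul_mem ((DUx p m).mul_mem
        (smul_pow_mem p m (dx_mul_xOp p) _ _ le_rfl)
        (smul_ff_neg_mem p m (dx_mul_xOp p) _ _ le_rfl))
        (smul_ff_mem p m (dx_mul_xOp p) _ _ le_rfl))
        (smul_sq_pow_mem p m (dx_mul_xOp p) _ _ le_rfl)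
    · have e : xOp p * dx p = -(yOp p * dy p) := by rw [yOp_mul_dy, neg_neg]
      rw [e, neg_neg, dx_eq]
      exact (DUy p m).mul_mem ((DUy p m).mul_mem ((DUy p m).mul_mem
        (smul_sq_pow_mem p m (dy_mul_yOp p) _ _ le_rfl)
        (smul_ff_mem p m (dy_mul_yOp p) _ _ le_rfl))
        (smul_ff_neg_mem p m (dy_mul_yOp p) _ _ le_rfl))
        (smul_pow_mem p m (dy_mul_yOp p) _ _ le_rfl)
  · simp
  · intro u v _ _ hu hv
    rw [map_add]; exact add_mem hu hv
  · intro c u _ hu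
    rw [xiQ_smulZ]; exact Submodule.smul_mem _ _ hu

/-- The homomorphism `ξ^{(m)} : U(𝔤_{ℤ_p})^{(m)} → H⁰(ℙ¹, 𝒟^{(m)})`. -/
def xi : Um p m →ₐ[ℤ_[p]] H0D p m where
  toFun u := ⟨xiQ p u, by
    obtain ⟨d, hd⟩ := u.2
    exact (mem_H0D_iff p m).2 ⟨d, xiQ_mem p m d _ hd⟩⟩
  map_one' := by ext1; exact map_one (xiQ p)
  map_mul' u v := by ext1; exact map_mul (xiQ p) u.1 v.1
  map_zero' := by ext1; exact map_zero (xiQ p)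
  map_add' u v := by ext1; exact map_add (xiQ p) u.1 v.1
  commutes' c := by ext1; exact (xiQ p).commutes (algebraMap ℤ_[p] ℚ_[p] c)

/-- The homomorphism of graded rings induced by `ξ^{(m)}`. -/
def grXi : (UmFil p m).gr →+* (H0DFil p m).gr :=
  RingFil.grMap (UmFil p m) (H0DFil p m) (xiQ p).toRingHom (xiQ_mem p m)

end Envelope

section Center

attribute [local instance] LieRing.ofAssociativeRing

variable (p : ℕ) [hp : Fact p.Prime] (m : ℕ)

theorem uea_induction {R L : Type*} [CommRing R] [LieRing L] [LieAlgebra R L]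
    (S : Subalgebra R (UniversalEnvelopingAlgebra R L))
    (h : ∀ x : L, UniversalEnvelopingAlgebra.ι R x ∈ S) (u : UniversalEnvelopingAlgebra R L) :
    u ∈ S := by
  let l : L →ₗ⁅R⁆ S :=
    { toFun := fun x => ⟨UniversalEnvelopingAlgebra.ι R x, h x⟩
      map_add' := fun x y => by ext1; exact (UniversalEnvelopingAlgebra.ι R).toLinearMap.map_add x y
      map_smul' := fun c x => by
        ext1; exact (UniversalEnvelopingAlgebra.ι R).toLinearMap.map_smul c x
      map_lie' := fun {x y} => by ext1; exact LieHom.map_lie (UniversalEnvelopingAlgebra.ι R) x y }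
  have e : S.val.comp (UniversalEnvelopingAlgebra.lift R l) = AlgHom.id R _ := by
    apply UniversalEnvelopingAlgebra.hom_ext
    ext1 x
    have := UniversalEnvelopingAlgebra.lift_ι_apply R l x
    exact congrArg Subtype.val this
  have := DFunLike.congr_fun e u
  rw [← show S.val (UniversalEnvelopingAlgebra.lift R l u) = u from this]
  exact Subtype.property _

/-- The Lie algebra homomorphism `𝔤_{ℤ_p} → 𝔤 → U(𝔤)`. -/
def lieIncl : Matrix (Fin 2) (Fin 2) ℤ_[p] →ₗ⁅ℤ_[p]⁆ Ug p where
  toFun X := UniversalEnvelopingAlgebra.ι ℚ_[p] (X.map (algebraMap ℤ_[p] ℚ_[p]))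
  map_add' X Y := by
    rw [Matrix.map_add _ (map_add _)]
    exact (UniversalEnvelopingAlgebra.ι ℚ_[p]).toLinearMap.map_add _ _
  map_smul' c X := by
    rw [← algebraMap_smul ℚ_[p] (RingHom.id _ c)]
    have : (c • X).map (algebraMap ℤ_[p] ℚ_[p]) =
        (algebraMap ℤ_[p] ℚ_[p] c) • X.map (algebraMap ℤ_[p] ℚ_[p]) := by
      ext i j; simp
    rw [this]
    exact (UniversalEnvelopingAlgebra.ι ℚ_[p]).toLinearMap.map_smul _ _
  map_lie' := by
    intro X Y
    rw [← LieHom.map_lie]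
    have h : ⁅X, Y⁆.map (algebraMap ℤ_[p] ℚ_[p]) =
        ⁅X.map (algebraMap ℤ_[p] ℚ_[p]), Y.map (algebraMap ℤ_[p] ℚ_[p])⁆ := by
      rw [LieRing.of_associative_ring_bracket, LieRing.of_associative_ring_bracket,
        Matrix.map_sub _ (map_sub _), Matrix.map_mul, Matrix.map_mul]
    rw [h]

/-- The canonical homomorphism `U(𝔤_{ℤ_p}) → U(𝔤)`. -/
def UgZToUg : UgZ p →ₐ[ℤ_[p]] Ug p := UniversalEnvelopingAlgebra.lift ℤ_[p] (lieIncl p)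

theorem UgZToUg_ι (X : Matrix (Fin 2) (Fin 2) ℤ_[p]) :
    UgZToUg p (UniversalEnvelopingAlgebra.ι ℤ_[p] X) =
      UniversalEnvelopingAlgebra.ι ℚ_[p] (X.map (algebraMap ℤ_[p] ℚ_[p])) :=
  UniversalEnvelopingAlgebra.lift_ι_apply _ _ _

theorem ι_eq (X : Matrix (Fin 2) (Fin 2) ℚ_[p]) :
    UniversalEnvelopingAlgebra.ι ℚ_[p] X =
      X 0 1 • eU p + X 0 0 • h₁U p + X 1 1 • h₂U p + X 1 0 • fU p := by
  have h : X = X 0 1 • !![0, 1; 0, 0] + X 0 0 • !![1, 0; 0, 0] + X 1 1 • !![0, 0; 0, 1] +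
      X 1 0 • !![0, 0; 1, 0] := by
    ext i j
    fin_cases i <;> fin_cases j <;> simp
  change (UniversalEnvelopingAlgebra.ι ℚ_[p]).toLinearMap X =
    X 0 1 • (UniversalEnvelopingAlgebra.ι ℚ_[p]).toLinearMap _ +
    X 0 0 • (UniversalEnvelopingAlgebra.ι ℚ_[p]).toLinearMap _ +
    X 1 1 • (UniversalEnvelopingAlgebra.ι ℚ_[p]).toLinearMap _ +
    X 1 0 • (UniversalEnvelopingAlgebra.ι ℚ_[p]).toLinearMap _
  conv_lhs => rw [h]
  simp only [LinearMap.map_add, LinearMap.map_smul]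

theorem UgZToUg_mem (u : UgZ p) : UgZToUg p u ∈ Um p m := by
  refine uea_induction ((Um p m).comap (UgZToUg p)) (fun X => ?_) u
  rw [Subalgebra.mem_comap, UgZToUg_ι, ι_eq]
  simp only [Matrix.map_apply, algebraMap_smul]
  have hg : ∀ a b c l, pbw p m (eU p) (h₁U p) (h₂U p) (fU p) a b c l ∈ Um p m := fun a b c l =>
    ⟨_, Submodule.subset_span ⟨a, b, c, l, le_rfl, rfl⟩⟩
  have he : eU p ∈ Um p m := by simpa [pbw, ff_zero, w_zero, w_one] using hg 1 0 0 0
  have hh : h₁U p ∈ Um p m := by simpa [pbw, ff_zero, ff_one, w_zero, w_one] using hg 0 1 0 0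
  have hk : h₂U p ∈ Um p m := by simpa [pbw, ff_zero, ff_one, w_zero, w_one] using hg 0 0 1 0
  have hf : fU p ∈ Um p m := by simpa [pbw, ff_zero, w_zero, w_one] using hg 0 0 0 1
  exact add_mem (add_mem (add_mem (Subalgebra.smul_mem _ he _) (Subalgebra.smul_mem _ hh _))
    (Subalgebra.smul_mem _ hk _)) (Subalgebra.smul_mem _ hf _)

/-- The canonical homomorphism `U(𝔤_{ℤ_p}) → U(𝔤_{ℤ_p})^{(m)}`. -/
def UgZToUm : UgZ p →ₐ[ℤ_[p]] Um p m := (UgZToUg p).codRestrict (Um p m) (UgZToUg_mem p m)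

/-- The center `Z(𝔤_{ℤ_p})` of `U(𝔤_{ℤ_p})`. -/
abbrev Zg : Subalgebra ℤ_[p] (UgZ p) := Subalgebra.center ℤ_[p] (UgZ p)

theorem Zg_central (z : Zg p) (u : Ug p) : UgZToUg p z * u = u * UgZToUg p z := by
  have hz : ∀ v, v * (z : UgZ p) = z * v := Subalgebra.mem_center_iff.1 z.2
  have hX : ∀ X : Matrix (Fin 2) (Fin 2) ℤ_[p],
      UgZToUg p z * UniversalEnvelopingAlgebra.ι ℚ_[p] (X.map (algebraMap ℤ_[p] ℚ_[p])) =
      UniversalEnvelopingAlgebra.ι ℚ_[p] (X.map (algebraMap ℤ_[p] ℚ_[p])) * UgZToUg p z := by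
    intro X
    rw [← UgZToUg_ι, ← map_mul, ← map_mul, hz]
  have h1 : ∀ a b c d : ℤ_[p], (!![a, b; c, d]).map (algebraMap ℤ_[p] ℚ_[p]) =
      !![algebraMap ℤ_[p] ℚ_[p] a, algebraMap ℤ_[p] ℚ_[p] b; algebraMap ℤ_[p] ℚ_[p] c,
        algebraMap ℤ_[p] ℚ_[p] d] := by
    intro a b c d
    ext i j
    fin_cases i <;> fin_cases j <;> rfl
  have he := hX !![0, 1; 0, 0]
  have hh := hX !![1, 0; 0, 0]
  have hk := hX !![0, 0; 0, 1]
  have hf := hX !![0, 0; 1, 0]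
  rw [h1, map_one, map_zero] at he hh hk hf
  have hu : u ∈ Subalgebra.centralizer ℚ_[p] {UgZToUg p z} := by
    refine uea_induction _ (fun X => ?_) u
    rw [Subalgebra.mem_centralizer_iff]
    intro g hg
    rw [Set.mem_singleton_iff.1 hg, ι_eq]
    change _ * eU p = eU p * _ at he
    change _ * h₁U p = h₁U p * _ at hh
    change _ * h₂U p = h₂U p * _ at hk
    change _ * fU p = fU p * _ at hf
    simp only [mul_add, add_mul, mul_smul_comm, smul_mul_assoc, he, hh, hk, hf]
  exact (Subalgebra.mem_centralizer_iff ℚ_[p]).1 hu _ rfl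

/-- The coefficient of `x^k`. -/
def coeffL (k : ℤ) : Lau p →ₗ[ℚ_[p]] ℚ_[p] := (monoBasis p).coord k

theorem coeffL_T (k n : ℤ) :
    coeffL p k (LaurentPolynomial.T n) = if n = k then (1 : ℚ_[p]) else 0 := by
  rw [coeffL, ← monoBasis_apply, Module.Basis.coord_apply, Module.Basis.repr_self,
    Finsupp.single_apply]

theorem coeffL_T_self (n : ℤ) : coeffL p n (LaurentPolynomial.T n) = 1 := by
  rw [coeffL_T, if_pos rfl]

theorem coeffL_ext {v u : Lau p} (h : ∀ k, coeffL p k v = coeffL p k u) : v = u :=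
  (monoBasis p).ext_elem h

theorem coeffL_euler (k : ℤ) (v : Lau p) :
    coeffL p k ((xOp p * dx p) v) = (k : ℚ_[p]) * coeffL p k v := by
  have h : (coeffL p k).comp (xOp p * dx p) = (k : ℚ_[p]) • coeffL p k :=
    (monoBasis p).ext fun n => by
      rw [monoBasis_apply, LinearMap.comp_apply, euler_T, LinearMap.map_smul, LinearMap.smul_apply,
        coeffL_T]
      split_ifs with hn
      · rw [hn]
      · simp
  exact DFunLike.congr_fun h v

theorem coeffL_dx (k : ℤ) (v : Lau p) :
    coeffL p k (dx p v) = ((k + 1 : ℤ) : ℚ_[p]) * coeffL p (k + 1) v := by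
  have h : (coeffL p k).comp (dx p) = ((k + 1 : ℤ) : ℚ_[p]) • coeffL p (k + 1) :=
    (monoBasis p).ext fun n => by
      rw [monoBasis_apply, LinearMap.comp_apply, dx_T, LinearMap.map_smul, LinearMap.smul_apply,
        coeffL_T, coeffL_T]
      by_cases hn : n = k + 1
      · rw [if_pos hn, if_pos (by omega), hn]
      · rw [if_neg hn, if_neg (by omega)]; simp
  exact DFunLike.congr_fun h v

theorem coeffL_dy (k : ℤ) (v : Lau p) :
    coeffL p k (dy p v) = ((1 - k : ℤ) : ℚ_[p]) * coeffL p (k - 1) v := by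
  have h : (coeffL p k).comp (dy p) = ((1 - k : ℤ) : ℚ_[p]) • coeffL p (k - 1) :=
    (monoBasis p).ext fun n => by
      rw [monoBasis_apply, LinearMap.comp_apply, dy_T, LinearMap.map_smul, LinearMap.smul_apply,
        coeffL_T, coeffL_T]
      by_cases hn : n = k - 1
      · rw [if_pos hn, if_pos (by omega), hn]; push_cast; ring_nf
      · rw [if_neg hn, if_neg (by omega)]; simp
  exact DFunLike.congr_fun h v

theorem op_scalar {P : Op p} (h1 : P * dx p = dx p * P)
    (h2 : P * (xOp p * dx p) = xOp p * dx p * P) (h3 : P * dy p = dy p * P) :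
    P = coeffL p 0 (P 1) • (1 : Op p) := by
  have hw : ∀ n : ℤ, P (LaurentPolynomial.T n) =
      coeffL p n (P (LaurentPolynomial.T n)) • LaurentPolynomial.T n := by
    intro n
    refine coeffL_ext p fun k => ?_
    rw [LinearMap.map_smul, coeffL_T]
    by_cases hk : n = k
    · rw [if_pos hk, hk]; simp
    · rw [if_neg hk, smul_zero]
      have e := DFunLike.congr_fun h2 (LaurentPolynomial.T n)
      rw [Module.End.mul_apply, euler_T, LinearMap.map_smul, Module.End.mul_apply (xOp p * dx p)] at e
      have e' := congrArg (coeffL p k) e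
      rw [coeffL_euler, LinearMap.map_smul, smul_eq_mul, ← sub_eq_zero, ← sub_mul] at e'
      refine (mul_eq_zero.1 e').resolve_left (sub_ne_zero.2 ?_)
      exact_mod_cast hk
  set g : ℤ → ℚ_[p] := fun n => coeffL p n (P (LaurentPolynomial.T n)) with hg
  have hw' : ∀ n : ℤ, P (LaurentPolynomial.T n) = g n • LaurentPolynomial.T n := hw
  have g1 : ∀ n : ℤ, n ≠ 0 → g (n - 1) = g n := by
    intro n hn
    have e := DFunLike.congr_fun h1 (LaurentPolynomial.T n)
    rw [Module.End.mul_apply, dx_T, LinearMap.map_smul, hw', Module.End.mul_apply, hw',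
      LinearMap.map_smul, dx_T] at e
    have e' := congrArg (coeffL p (n - 1)) e
    simp only [LinearMap.map_smul, coeffL_T_self, smul_eq_mul, mul_one] at e'
    have hn' : (n : ℚ_[p]) ≠ 0 := by exact_mod_cast hn
    rw [mul_comm (g n)] at e'
    exact mul_left_cancel₀ hn' e'
  have g2 : g (-1 + 1) = g (-1) := by
    have e := DFunLike.congr_fun h3 (LaurentPolynomial.T (-1))
    rw [Module.End.mul_apply, dy_T, LinearMap.map_smul, hw', Module.End.mul_apply, hw',
      LinearMap.map_smul, dy_T] at e
    have e' := congrArg (coeffL p (-1 + 1)) e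
    simpa only [LinearMap.map_smul, coeffL_T_self, smul_eq_mul, mul_one, Int.cast_neg, Int.cast_one,
      neg_neg, one_mul] using e'
  have g3 : ∀ n : ℤ, g (n - 1) = g n := by
    intro n
    by_cases hn : n = 0
    · rw [hn]; exact g2.symm
    · exact g1 n hn
  have g4 : ∀ n : ℤ, g n = g 0 := by
    intro n
    induction n using Int.induction_on with
    | zero => rfl
    | succ i ih => rw [← ih, ← g3 (i + 1), add_sub_cancel_right]
    | pred i ih => rw [g3, ih]
  refine op_ext fun n => ?_
  rw [hw', g4, LinearMap.smul_apply, Module.End.one_apply, ← LaurentPolynomial.T_zero]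

theorem one_coeff : coeffL p 0 (1 : Lau p) = 1 := by
  rw [← LaurentPolynomial.T_zero, coeffL_T_self]

theorem xiQ_center (z : Zg p) :
    xiQ p (UgZToUg p z) = coeffL p 0 (xiQ p (UgZToUg p z) 1) • (1 : Op p) := by
  have h : ∀ u : Ug p, xiQ p (UgZToUg p z) * xiQ p u = xiQ p u * xiQ p (UgZToUg p z) := by
    intro u
    rw [← map_mul, Zg_central, map_mul]
  refine op_scalar p ?_ ?_ ?_
  · rw [← xiQ_e]; exact h _
  · rw [← xiQ_h₂]; exact h _
  · rw [← xiQ_f]; exact h _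

/-- Operators that preserve the Laurent polynomials with coefficients in `ℤ_p`. -/
def integralOps : Subalgebra ℤ_[p] (Op p) where
  carrier := {P | ∀ v : Lau p, (∀ k, ‖coeffL p k v‖ ≤ 1) → ∀ k, ‖coeffL p k (P v)‖ ≤ 1}
  mul_mem' hP hQ v hv := hP _ (hQ v hv)
  add_mem' {P Q} hP hQ v hv k := by
    rw [LinearMap.add_apply, map_add]
    exact (Padic.nonarchimedean _ _).trans (max_le (hP v hv k) (hQ v hv k))
  algebraMap_mem' c v hv k := by
    rw [Algebra.algebraMap_eq_smul_one, ← algebraMap_smul ℚ_[p] c, LinearMap.smul_apply,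
      Module.End.one_apply, map_smul, smul_eq_mul, norm_mul]
    exact mul_le_one₀ c.2 (norm_nonneg _) (hv k)

theorem xiQ_integral (u : UgZ p) : xiQ p (UgZToUg p u) ∈ integralOps p := by
  have hm : ∀ (n : ℤ) (c : ℚ_[p]), ‖c‖ ≤ 1 → ‖(n : ℚ_[p]) * c‖ ≤ 1 := by
    intro n c hc
    rw [norm_mul]
    exact mul_le_one₀ (Padic.norm_int_le_one n) (norm_nonneg _) hc
  have h1 : dx p ∈ integralOps p := fun v hv k => by rw [coeffL_dx]; exact hm _ _ (hv _)
  have h2 : xOp p * dx p ∈ integralOps p := fun v hv k => by rw [coeffL_euler]; exact hm _ _ (hv _)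
  have h3 : dy p ∈ integralOps p := fun v hv k => by rw [coeffL_dy]; exact hm _ _ (hv _)
  let S : Subalgebra ℤ_[p] (UgZ p) :=
    { carrier := {u | xiQ p (UgZToUg p u) ∈ integralOps p}
      mul_mem' := fun {a b} ha hb => by
        change xiQ p (UgZToUg p (a * b)) ∈ integralOps p
        rw [map_mul, map_mul]; exact mul_mem ha hb
      add_mem' := fun {a b} ha hb => by
        change xiQ p (UgZToUg p (a + b)) ∈ integralOps p
        rw [map_add, map_add]; exact add_mem ha hb
      algebraMap_mem' := fun c => by
        change xiQ p (UgZToUg p (algebraMap _ _ c)) ∈ integralOps p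
        rw [AlgHom.commutes, Algebra.algebraMap_eq_smul_one, xiQ_smulZ, map_one]
        exact Subalgebra.smul_mem _ (one_mem _) _ }
  refine uea_induction S (fun X => ?_) u
  change xiQ p (UgZToUg p _) ∈ integralOps p
  rw [UgZToUg_ι, ι_eq]
  simp only [Matrix.map_apply, algebraMap_smul, map_add, xiQ_smulZ, xiQ_e, xiQ_h₁, xiQ_h₂, xiQ_f]
  exact add_mem (add_mem (add_mem (Subalgebra.smul_mem _ h1 _)
    (Subalgebra.smul_mem _ (neg_mem h2) _)) (Subalgebra.smul_mem _ h2 _))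
    (Subalgebra.smul_mem _ h3 _)

theorem xiQ_center_norm (z : Zg p) : ‖coeffL p 0 (xiQ p (UgZToUg p z) 1)‖ ≤ 1 := by
  refine xiQ_integral p z 1 (fun k => ?_) 0
  rw [← LaurentPolynomial.T_zero, coeffL_T]
  split_ifs <;> simp

/-- The character `θ₀ : Z(𝔤_{ℤ_p}) → ℤ_p`, the restriction of `ξ^{(m)}` to the center:
`ξ^{(m)}(z) = θ₀(z) · 1`. -/
def theta0 : Zg p →ₐ[ℤ_[p]] ℤ_[p] where
  toFun z := ⟨coeffL p 0 (xiQ p (UgZToUg p z) 1), xiQ_center_norm p z⟩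
  map_one' := by
    apply Subtype.ext
    change coeffL p 0 (xiQ p (UgZToUg p 1) 1) = 1
    rw [map_one (UgZToUg p), map_one (xiQ p), Module.End.one_apply, one_coeff]
  map_mul' z z' := by
    apply Subtype.ext
    change coeffL p 0 (xiQ p (UgZToUg p (z * z')) 1) = coeffL p 0 _ * coeffL p 0 _
    rw [map_mul, map_mul]
    conv_lhs => rw [xiQ_center p z, xiQ_center p z']
    rw [Module.End.mul_apply, LinearMap.smul_apply, LinearMap.smul_apply, Module.End.one_apply,
      Module.End.one_apply, map_smul, map_smul, one_coeff, smul_eq_mul, smul_eq_mul, mul_one]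
  map_zero' := by
    apply Subtype.ext
    change coeffL p 0 (xiQ p (UgZToUg p 0) 1) = 0
    rw [map_zero, map_zero, LinearMap.zero_apply, map_zero]
  map_add' z z' := by
    apply Subtype.ext
    change coeffL p 0 (xiQ p (UgZToUg p (z + z')) 1) = coeffL p 0 _ + coeffL p 0 _
    rw [map_add, map_add, LinearMap.add_apply, map_add]
  commutes' c := by
    apply Subtype.ext
    change coeffL p 0 (xiQ p (UgZToUg p (algebraMap _ _ c)) 1) = c
    rw [AlgHom.commutes, Algebra.algebraMap_eq_smul_one, xiQ_smulZ, map_one (xiQ p),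
      ← algebraMap_smul ℚ_[p] c (1 : Op p), LinearMap.smul_apply, LinearMap.map_smul,
      Module.End.one_apply, one_coeff, smul_eq_mul, mul_one]
    rfl

theorem xiQ_eq_theta0 (z : Zg p) : xiQ p (UgZToUg p z) = theta0 p z • (1 : Op p) := by
  rw [← algebraMap_smul ℚ_[p] (theta0 p z)]
  exact xiQ_center p z

instance algZgUm : Algebra (Zg p) (Um p m) :=
  RingHom.toAlgebra' ((UgZToUm p m).toRingHom.comp (Zg p).val.toRingHom) fun z u => by
    ext1; exact Zg_central p z u

instance algZgZp : Algebra (Zg p) ℤ_[p] := (theta0 p).toRingHom.toAlgebra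

instance algZgH0D : Algebra (Zg p) (H0D p m) :=
  Algebra.compHom (H0D p m) (theta0 p).toRingHom

/-- `U(𝔤_{ℤ_p})^{(m)}_{θ₀} = U(𝔤_{ℤ_p})^{(m)} ⊗_{Z(𝔤_{ℤ_p}), θ₀} ℤ_p`. -/
abbrev UmTheta : Type := TensorProduct (Zg p) (Um p m) ℤ_[p]

/-- `ξ^{(m)}` as a homomorphism of `Z(𝔤_{ℤ_p})`-algebras. -/
def xiZg : Um p m →ₐ[Zg p] H0D p m :=
  { (xi p m).toRingHom with
    commutes' := fun z => by
      ext1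
      exact xiQ_eq_theta0 p z |>.trans (Algebra.algebraMap_eq_smul_one _).symm }

/-- The structure map `ℤ_p → H⁰(ℙ¹, 𝒟^{(m)})` as a homomorphism of `Z(𝔤_{ℤ_p})`-algebras. -/
def scalarZg : ℤ_[p] →ₐ[Zg p] H0D p m :=
  { algebraMap ℤ_[p] (H0D p m) with commutes' := fun _ => rfl }

/-- The homomorphism `ξ₀^{(m)} : U(𝔤_{ℤ_p})^{(m)}_{θ₀} → H⁰(ℙ¹, 𝒟^{(m)})` induced by `ξ^{(m)}`,
`u ⊗ c ↦ c · ξ^{(m)}(u)`. -/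
def xi0 : UmTheta p m →ₐ[Zg p] H0D p m :=
  Algebra.TensorProduct.lift (xiZg p m) (scalarZg p m) fun u c =>
    (Algebra.commutes c (xiZg p m u)).symm

end Center

section Symbol

variable (p : ℕ) [hp : Fact p.Prime] (m : ℕ)

/-- The commutator `P ↦ [P, x]`. -/
def adx : Op p →ₗ[ℚ_[p]] Op p := LinearMap.mulRight ℚ_[p] (xOp p) - LinearMap.mulLeft ℚ_[p] (xOp p)

/-- The principal symbol of order `d`: the coefficient of `∂_x^d` in an operator `P` of order `≤ d`,
computed as `(1 / d!) [⋯[[P, x], x]⋯, x] (1)`. -/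
def symb (d : ℕ) : Op p →ₗ[ℚ_[p]] Lau p :=
  ((d ! : ℚ_[p])⁻¹) • (LinearMap.applyₗ (1 : Lau p)).comp ((adx p) ^ d)

theorem symb_apply (d : ℕ) (P : Op p) :
    symb p d P = (d ! : ℚ_[p])⁻¹ • (((adx p) ^ d) P) 1 := rfl

/-- Operators annihilated by the `(d + 1)`-fold commutator with `x`. -/
def ordLE (d : ℕ) : Submodule ℚ_[p] (Op p) := LinearMap.ker ((adx p) ^ (d + 1))

theorem adx_apply (P : Op p) : adx p P = P * xOp p - xOp p * P := rfl

theorem adx_mul (P Q : Op p) : adx p (P * Q) = adx p P * Q + P * adx p Q := by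
  simp only [adx_apply, sub_mul, mul_sub, mul_assoc]
  abel

theorem mem_ordLE {d : ℕ} {P : Op p} : P ∈ ordLE p d ↔ ((adx p) ^ (d + 1)) P = 0 := Iff.rfl

theorem adx_mem {d : ℕ} {P : Op p} (h : P ∈ ordLE p (d + 1)) : adx p P ∈ ordLE p d := by
  rw [mem_ordLE] at *
  rwa [pow_succ, Module.End.mul_apply] at h

theorem adx_zero_of_mem {P : Op p} (h : P ∈ ordLE p 0) : adx p P = 0 := by
  rw [mem_ordLE] at h
  simpa using h

theorem ordLE_mono : Monotone (ordLE p) := by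
  refine monotone_nat_of_le_succ fun d P hP => ?_
  rw [mem_ordLE] at *
  rw [pow_succ', Module.End.mul_apply, hP, map_zero]

theorem adx_pow_mul : ∀ (n i j : ℕ), i + j = n → ∀ P ∈ ordLE p i, ∀ Q ∈ ordLE p j,
    ((adx p) ^ n) (P * Q) = ((i + j).choose i) • (((adx p) ^ i) P * ((adx p) ^ j) Q) ∧
      P * Q ∈ ordLE p n := by
  intro n
  induction n with
  | zero =>
    intro i j hij P hP Q hQ
    obtain ⟨rfl, rfl⟩ : i = 0 ∧ j = 0 := by omega
    refine ⟨by simp, ?_⟩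
    rw [mem_ordLE, zero_add, pow_one, adx_mul, adx_zero_of_mem p hP, adx_zero_of_mem p hQ]
    simp
  | succ n ih =>
    intro i j hij P hP Q hQ
    have key : ∀ R : Op p, (R = adx p P * Q + P * adx p Q) →
        ((adx p) ^ n) R = ((i + j).choose i) • (((adx p) ^ i) P * ((adx p) ^ j) Q) ∧
          R ∈ ordLE p n := by
      rintro R rfl
      rw [map_add]
      rcases i with _ | i
      · obtain rfl : j = n + 1 := by omega
        obtain ⟨h1, h2⟩ := ih 0 n (by omega) P hP (adx p Q) (adx_mem p hQ)
        rw [adx_zero_of_mem p hP, zero_mul, map_zero, zero_add, zero_add]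
        refine ⟨?_, by simpa using h2⟩
        rw [h1, pow_succ, Module.End.mul_apply]
        simp
      · rcases j with _ | j
        · obtain rfl : i = n := by omega
          obtain ⟨h1, h2⟩ := ih i 0 (by omega) (adx p P) (adx_mem p hP) Q hQ
          rw [adx_zero_of_mem p hQ, mul_zero, map_zero, add_zero, add_zero]
          refine ⟨?_, by simpa using h2⟩
          rw [h1, pow_succ, Module.End.mul_apply]
          simp
        · obtain ⟨h1, h2⟩ := ih i (j + 1) (by omega) (adx p P) (adx_mem p hP) Q hQ
          obtain ⟨h3, h4⟩ := ih (i + 1) j (by omega) P hP (adx p Q) (adx_mem p hQ)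
          refine ⟨?_, add_mem h2 h4⟩
          rw [h1, h3, ← Module.End.mul_apply, ← pow_succ, ← Module.End.mul_apply, ← pow_succ,
            ← add_smul]
          congr 1
          rw [show i + 1 + (j + 1) = (i + (j + 1)) + 1 by omega, Nat.choose_succ_succ,
            show i + 1 + j = i + (j + 1) by omega]
    obtain ⟨h1, h2⟩ := key _ (adx_mul p P Q)
    refine ⟨?_, ?_⟩
    · rw [pow_succ, Module.End.mul_apply]; exact h1
    · rw [mem_ordLE, pow_succ, Module.End.mul_apply]; exact h2

theorem commute_x_apply {P : Op p} (h : adx p P = 0) (v : Lau p) : P v = P 1 * v := by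
  have h1 : ∀ u : Lau p, P (LaurentPolynomial.T 1 * u) = LaurentPolynomial.T 1 * P u := by
    intro u
    have := DFunLike.congr_fun (sub_eq_zero.1 h) u
    exact this
  have h2 : ∀ n : ℤ, P (LaurentPolynomial.T n) = LaurentPolynomial.T n * P 1 := by
    intro n
    induction n using Int.induction_on with
    | zero => simp [LaurentPolynomial.T_zero]
    | succ i ih => rw [add_comm, LaurentPolynomial.T_add, h1, ih, mul_assoc]
    | pred i ih =>
      have e : (LaurentPolynomial.T (-i : ℤ) : Lau p) =
          LaurentPolynomial.T 1 * LaurentPolynomial.T (-i - 1 : ℤ) := by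
        rw [← LaurentPolynomial.T_add]; congr 1; ring
      rw [e, h1, mul_assoc] at ih
      exact (LaurentPolynomial.isUnit_T 1).mul_left_cancel ih
  have h3 : P = LinearMap.mulLeft ℚ_[p] (P 1) := op_ext fun n => by
    rw [h2, LinearMap.mulLeft_apply, mul_comm]
  exact DFunLike.congr_fun h3 v

theorem symb_mul {i j : ℕ} {P Q : Op p} (hP : P ∈ ordLE p i) (hQ : Q ∈ ordLE p j) :
    symb p (i + j) (P * Q) = symb p i P * symb p j Q := by
  rw [symb_apply, symb_apply, symb_apply, (adx_pow_mul p _ i j rfl P hP Q hQ).1,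
    LinearMap.smul_apply, Module.End.mul_apply, commute_x_apply p (P := ((adx p) ^ i) P),
    smul_mul_smul_comm, ← Nat.cast_smul_eq_nsmul ℚ_[p], smul_smul]
  · congr 1
    have h1 := fact_ne (p := p) i
    have h2 := fact_ne (p := p) j
    have h3 := fact_ne (p := p) (i + j)
    rw [Nat.cast_add_choose]
    field_simp
  · rw [mem_ordLE, pow_succ', Module.End.mul_apply] at hP
    exact hP

theorem symb_eq_zero {i d : ℕ} {P : Op p} (hP : P ∈ ordLE p i) (h : i < d) : symb p d P = 0 := by
  obtain ⟨k, rfl⟩ : ∃ k, d = i + 1 + k := ⟨d - (i + 1), by omega⟩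
  rw [mem_ordLE] at hP
  rw [symb_apply, add_comm, pow_add, Module.End.mul_apply, hP, map_zero, LinearMap.zero_apply,
    smul_zero]

theorem ord_mul {i j : ℕ} {P Q : Op p} (hP : P ∈ ordLE p i) (hQ : Q ∈ ordLE p j) :
    P * Q ∈ ordLE p (i + j) := (adx_pow_mul p _ i j rfl P hP Q hQ).2

theorem one_data : (1 : Op p) ∈ ordLE p 0 ∧ symb p 0 (1 : Op p) = 1 := by
  refine ⟨?_, ?_⟩
  · rw [mem_ordLE, zero_add, pow_one, adx_apply, one_mul, mul_one, sub_self]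
  · simp [symb_apply]

theorem ord_symb_pow_zero {P : Op p} {u : Lau p} (hP : P ∈ ordLE p 0) (hu : symb p 0 P = u)
    (n : ℕ) : P ^ n ∈ ordLE p 0 ∧ symb p 0 (P ^ n) = u ^ n := by
  induction n with
  | zero =>
    rw [pow_zero, pow_zero]
    exact one_data p
  | succ n ih =>
    have h1 := ord_mul p ih.1 hP
    have h2 := symb_mul p ih.1 hP
    rw [add_zero] at h1 h2
    refine ⟨?_, ?_⟩
    · rw [pow_succ]; exact h1
    · rw [pow_succ, pow_succ, h2, ih.2, hu]

theorem ord_symb_pow {P : Op p} {u : Lau p} (hP : P ∈ ordLE p 1) (hu : symb p 1 P = u)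
    (n : ℕ) : P ^ n ∈ ordLE p n ∧ symb p n (P ^ n) = u ^ n := by
  induction n with
  | zero =>
    rw [pow_zero, pow_zero]
    exact one_data p
  | succ n ih =>
    refine ⟨?_, ?_⟩
    · rw [pow_succ]; exact ord_mul p ih.1 hP
    · have := symb_mul p ih.1 hP
      rw [pow_succ, pow_succ, ← ih.2, ← hu]; exact this

theorem adx_xOp : adx p (xOp p) = 0 := sub_self _

theorem adx_yOp : adx p (yOp p) = 0 := op_ext fun n => by
  rw [adx_apply, LinearMap.sub_apply, Module.End.mul_apply, Module.End.mul_apply, xOp_T, yOp_T,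
    yOp_T, xOp_T]
  simp

theorem adx_dx : adx p (dx p) = 1 := by
  rw [adx_apply, dx_mul_xOp, add_sub_cancel_left]

theorem adx_dy : adx p (dy p) = -(xOp p * xOp p) := by
  rw [dy, map_neg, adx_mul, adx_mul, adx_xOp, adx_dx]
  simp

theorem x_data : xOp p ∈ ordLE p 0 ∧ symb p 0 (xOp p) = LaurentPolynomial.T 1 := by
  refine ⟨?_, ?_⟩
  · rw [mem_ordLE, zero_add, pow_one, adx_xOp]
  · simp [symb_apply, xOp]

theorem y_data : yOp p ∈ ordLE p 0 ∧ symb p 0 (yOp p) = LaurentPolynomial.T (-1) := by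
  refine ⟨?_, ?_⟩
  · rw [mem_ordLE, zero_add, pow_one, adx_yOp]
  · simp [symb_apply, yOp]

theorem dx_data : dx p ∈ ordLE p 1 ∧ symb p 1 (dx p) = 1 := by
  refine ⟨?_, ?_⟩
  · rw [mem_ordLE, pow_succ, pow_one, Module.End.mul_apply, adx_dx]
    simp [adx_apply]
  · rw [symb_apply, pow_one, adx_dx]; simp

theorem dy_data : dy p ∈ ordLE p 1 ∧ symb p 1 (dy p) = -LaurentPolynomial.T 2 := by
  refine ⟨?_, ?_⟩
  · rw [mem_ordLE, pow_succ, pow_one, Module.End.mul_apply, adx_dy, map_neg, adx_mul, adx_xOp]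
    simp
  · rw [symb_apply, pow_one, adx_dy, ← LaurentPolynomial.T_zero, LinearMap.neg_apply,
      Module.End.mul_apply, xOp_T, xOp_T]
    simp

theorem chart_symb {t δ : Op p} {u v : Lau p} (h1 : t ∈ ordLE p 0 ∧ symb p 0 t = u)
    (h2 : δ ∈ ordLE p 1 ∧ symb p 1 δ = v) (i a : ℕ) :
    t ^ i * (w p m a • δ ^ a) ∈ ordLE p a ∧
      symb p a (t ^ i * (w p m a • δ ^ a)) = u ^ i * (w p m a • v ^ a) := by
  obtain ⟨h3, h4⟩ := ord_symb_pow_zero p h1.1 h1.2 i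
  obtain ⟨h5, h6⟩ := ord_symb_pow p h2.1 h2.2 a
  have h7 : w p m a • δ ^ a ∈ ordLE p a := Submodule.smul_mem _ _ h5
  refine ⟨by simpa using ord_mul p h3 h7, ?_⟩
  have := symb_mul p h3 h7
  rw [zero_add] at this
  rw [this, h4, map_smul, h6]

theorem chartSpan_le_ordLE {t δ : Op p} {u v : Lau p} (h1 : t ∈ ordLE p 0 ∧ symb p 0 t = u)
    (h2 : δ ∈ ordLE p 1 ∧ symb p 1 δ = v) (d : ℕ) {P : Op p} (hP : P ∈ chartSpan p m t δ d) :
    P ∈ ordLE p d := by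
  have h : chartSpan p m t δ d ≤ (ordLE p d).restrictScalars ℤ_[p] := by
    rw [chartSpan, Submodule.span_le]
    rintro _ ⟨i, a, ha, rfl⟩
    exact ordLE_mono p ha (chart_symb p m h1 h2 i a).1
  exact h hP

/-- The `ℚ_p`-algebra `⨁_d 𝒯^{⊗ d}` of symbols over the generic fibre of `U_x ∩ U_y`: polynomials
in `∂_x` (the variable `X`) with coefficients in `ℚ_p[x, x⁻¹]`. -/
abbrev SymRing : Type := Polynomial (Lau p)

/-- Sections of `Sym(𝒯)^{(m)}` over an affine chart with coordinate `t` on which `𝒯` is free with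
generator `s`: the `ℤ_p[t]`-algebra generated by the divided powers `(q_i! / i!) v^i`, for the
sections `v = g s`, `g ∈ ℤ_p[t]`, of `𝒯`. -/
def symChart (t s : SymRing p) : Subalgebra ℤ_[p] (SymRing p) :=
  Algebra.adjoin ℤ_[p] ({t} ∪
    {z | ∃ g ∈ Algebra.adjoin ℤ_[p] {t}, ∃ i : ℕ, z = w p m i • (g * s) ^ i})

/-- Sections of `Sym(𝒯)^{(m)}` over `U_x`. -/
def SymUx : Subalgebra ℤ_[p] (SymRing p) :=
  symChart p m (Polynomial.C (LaurentPolynomial.T 1)) Polynomial.X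

/-- Sections of `Sym(𝒯)^{(m)}` over `U_y`; here `∂_y = -x² ∂_x`. -/
def SymUy : Subalgebra ℤ_[p] (SymRing p) :=
  symChart p m (Polynomial.C (LaurentPolynomial.T (-1)))
    (Polynomial.C (-LaurentPolynomial.T 2) * Polynomial.X)

/-- The graded ring `H⁰(ℙ¹, Sym(𝒯)^{(m)})` of global sections. -/
abbrev H0Sym : Subalgebra ℤ_[p] (SymRing p) := SymUx p m ⊓ SymUy p m

theorem chart_symChart {t δ : Op p} {u v : Lau p} (h1 : t ∈ ordLE p 0 ∧ symb p 0 t = u)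
    (h2 : δ ∈ ordLE p 1 ∧ symb p 1 δ = v) (d : ℕ) {P : Op p} (hP : P ∈ chartSpan p m t δ d) :
    Polynomial.monomial d (symb p d P) ∈
      symChart p m (Polynomial.C u) (Polynomial.C v * Polynomial.X) := by
  refine Submodule.span_induction (p := fun P _ => Polynomial.monomial d (symb p d P) ∈
    symChart p m (Polynomial.C u) (Polynomial.C v * Polynomial.X)) ?_ ?_ ?_ ?_ hP
  · rintro _ ⟨i, a, ha, rfl⟩
    obtain ⟨h3, h4⟩ := chart_symb p m h1 h2 i a
    rcases ha.lt_or_eq with h | rfl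
    · rw [symb_eq_zero p h3 h, map_zero]; exact zero_mem _
    · have e : Polynomial.monomial a (u ^ i * (w p m a • v ^ a)) =
          Polynomial.C u ^ i * (w p m a • (1 * (Polynomial.C v * Polynomial.X)) ^ a) := by
        rw [one_mul, mul_pow, mul_smul_comm, mul_smul_comm, ← Polynomial.smul_monomial, ← map_pow,
          ← map_pow, ← mul_assoc, ← map_mul, Polynomial.C_mul_X_pow_eq_monomial]
      rw [h4, e]
      have ht : Polynomial.C u ∈ symChart p m (Polynomial.C u) (Polynomial.C v * Polynomial.X) :=
        Algebra.subset_adjoin (Or.inl rfl)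
      have hs : w p m a • (1 * (Polynomial.C v * Polynomial.X)) ^ a ∈
          symChart p m (Polynomial.C u) (Polynomial.C v * Polynomial.X) :=
        Algebra.subset_adjoin (Or.inr ⟨1, one_mem _, a, rfl⟩)
      exact mul_mem (pow_mem ht _) hs
  · rw [map_zero, map_zero]; exact zero_mem _
  · intro P Q _ _ h h'
    rw [map_add, map_add]; exact add_mem h h'
  · intro c P _ h
    rw [← algebraMap_smul ℚ_[p] c P, map_smul, ← Polynomial.smul_monomial, algebraMap_smul]
    exact Subalgebra.smul_mem _ h _

/-- `∑ P_d t^d ↦ ∑ symb_d(P_d) ∂_x^d`. -/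
def symbPoly (P : Polynomial (Op p)) : SymRing p :=
  ∑ d ∈ P.support, Polynomial.monomial d (symb p d (P.coeff d))

theorem symbPoly_coeff (P : Polynomial (Op p)) (d : ℕ) :
    (symbPoly p P).coeff d = symb p d (P.coeff d) := by
  rw [symbPoly, Polynomial.finsetSum_coeff]
  simp only [Polynomial.coeff_monomial]
  rw [Finset.sum_ite_eq']
  split_ifs with h
  · rfl
  · rw [Polynomial.notMem_support_iff.1 h, map_zero]

theorem H0DFil_x {d : ℕ} {P : Op p} (h : P ∈ (H0DFil p m).F d) :
    P ∈ chartSpan p m (xOp p) (dx p) d := h.1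

theorem H0DFil_y {d : ℕ} {P : Op p} (h : P ∈ (H0DFil p m).F d) :
    P ∈ chartSpan p m (yOp p) (dy p) d := h.2

theorem H0DFil_ord {d : ℕ} {P : Op p} (h : P ∈ (H0DFil p m).F d) : P ∈ ordLE p d :=
  chartSpan_le_ordLE p m (x_data p) (dx_data p) d (H0DFil_x p m h)

theorem H0DFil_monomial {d : ℕ} {P : Op p} (h : P ∈ (H0DFil p m).F d) :
    Polynomial.monomial d (symb p d P) ∈ H0Sym p m := by
  have hx := chart_symChart p m (x_data p) (dx_data p) d (H0DFil_x p m h)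
  have hy := chart_symChart p m (y_data p) (dy_data p) d (H0DFil_y p m h)
  have e1 : Polynomial.C (1 : Lau p) * Polynomial.X = Polynomial.X := by
    rw [Polynomial.C_1, one_mul]
  rw [e1] at hx
  exact Algebra.mem_inf.2 ⟨hx, hy⟩

/-- The homomorphism sending a formal sum `∑ P_d t^d` with `P_d ∈ H⁰(ℙ¹, 𝒟^{(m)}_d)` to the sum of
the principal symbols of order `d` of the `P_d`. -/
def symbRees : (H0DFil p m).rees →+* H0Sym p m where
  toFun P := ⟨symbPoly p P.1, sum_mem fun d _ => H0DFil_monomial p m (P.2 d)⟩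
  map_one' := by
    ext1
    refine Polynomial.ext fun d => ?_
    change (symbPoly p 1).coeff d = (1 : SymRing p).coeff d
    rw [symbPoly_coeff, Polynomial.coeff_one, Polynomial.coeff_one]
    split_ifs with h
    · rw [h]; exact (one_data p).2
    · rw [map_zero]
  map_mul' P Q := by
    ext1
    refine Polynomial.ext fun d => ?_
    change (symbPoly p (P.1 * Q.1)).coeff d = (symbPoly p P.1 * symbPoly p Q.1).coeff d
    rw [symbPoly_coeff, Polynomial.coeff_mul, Polynomial.coeff_mul, map_sum]
    refine Finset.sum_congr rfl fun ij hij => ?_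
    have hij' : ij.1 + ij.2 = d := by simpa using hij
    rw [symbPoly_coeff, symbPoly_coeff, ← hij']
    exact symb_mul p (H0DFil_ord p m (P.2 _)) (H0DFil_ord p m (Q.2 _))
  map_zero' := by
    ext1
    refine Polynomial.ext fun d => ?_
    change (symbPoly p 0).coeff d = (0 : SymRing p).coeff d
    rw [symbPoly_coeff, Polynomial.coeff_zero, Polynomial.coeff_zero, map_zero]
  map_add' P Q := by
    ext1
    refine Polynomial.ext fun d => ?_
    change (symbPoly p (P.1 + Q.1)).coeff d = (symbPoly p P.1 + symbPoly p Q.1).coeff d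
    rw [symbPoly_coeff, Polynomial.coeff_add, Polynomial.coeff_add, map_add, symbPoly_coeff,
      symbPoly_coeff]

/-- The canonical map `gr H⁰(ℙ¹, 𝒟^{(m)}) → H⁰(ℙ¹, Sym(𝒯)^{(m)})` given by principal symbols. -/
def symbolMap : (H0DFil p m).gr →+* H0Sym p m :=
  Ideal.Quotient.lift (H0DFil p m).reesIdeal (symbRees p m) fun P hP => by
    ext1
    refine Polynomial.ext fun d => ?_
    change (symbPoly p P.1).coeff d = (0 : SymRing p).coeff d
    rw [symbPoly_coeff, Polynomial.coeff_zero]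
    have h := hP d
    rcases d with _ | d
    · have h0 : P.1.coeff 0 = 0 := by simpa [RingFil.pred] using h
      rw [h0, map_zero]
    · exact symb_eq_zero p (H0DFil_ord p m h) d.lt_succ_self

end Symbol

/-- Through the ring homomorphism `g : B → C`, the ring `C` is a finitely generated (left)
`B`-module. -/
def FiniteVia {B C : Type*} [Semiring B] [Semiring C] (g : B →+* C) : Prop :=
  letI : Module B C := Module.compHom C g
  Module.Finite B C

end ArithDiff

end

noncomputable section

namespace ArithDiff

open scoped Nat

/-! ### Lattices of Laurent polynomials weighted by `q_d! / d!` -/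

section LaurentLattices

variable (p : ℕ) [hp : Fact p.Prime] (m : ℕ)

/-! Write `w_d = q_d! / d!`. On `ℙ¹` the sheaf `𝒯^{⊗ d}` is `𝒪(2d)`. Since `𝒯` has rank one and `w_i
w_j ∈ ℤ_p w_{i+j}`, the degree-`d` part of `Sym(𝒯)^{(m)}` is `w_d 𝒯^{⊗ d}`. So the global sections
of degree `d` form the lattice with basis `w_d x^k ∂_x^d`, `0 ≤ k ≤ 2d` (`H0Sym_coeff`,
`monomial_mem_H0Sym`), and every claim reduces to a claim about these monomials.

Symbols. Each monomial lifts explicitly to a global operator of order `≤ d`, so no vanishing of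
cohomology is needed: `w_d x^k ∂_x^d` works for `k ≤ d`, and `± w_d y^{2d-k} ∂_y^d` for `k > d`
(`exists_symb_eq_T`). Regularity on the other chart follows from `(t² δ)^d = t^d (tδ)(tδ + 1) ⋯ (tδ
+ d - 1)`, because an integer shift of `tδ` does not change the span of the weighted falling
factorials. Conversely, an operator whose symbol of order `d` vanishes has zero leading coefficient
on each chart, hence has order `< d` globally (`H0DFil_mem_pred`).

Finiteness. The weights are multiplicative up to units along steps of `p^m`: `|w_{p^m+n}| =
|w_{p^m}| |w_n|`. Hence for `n ≥ p^m` every monomial of degree `p^m + n` is the symbol of a unit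
multiple of `w_{p^m} e^{p^m}` or `w_{p^m} f^{p^m}` times a monomial of degree `n`
(`exists_symb_mul_eq`). The finitely many monomials of degree `< 2 p^m` therefore generate over `gr
U^{(m)}`, and induction on the order shows that lifts of them generate `H⁰(𝒟^{(m)})` over `U^{(m)}`.

Cokernel. Without the weight, `x^k ∂_x^d` is the symbol of a monomial in `e, h₂, f`. So, by
induction on the order, every global operator is carried into the image by some power of `p`
(`H0DFil_le_xiSaturation`). One exponent that serves the finitely many generators serves all
operators, because the operators it serves form a left `U^{(m)}`-submodule. -/

/-- The `ℤ_p`-lattice of Laurent polynomials spanned by `(q_d! / d!) x^k`, `k ∈ S`. -/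
def lauSpan (S : Set ℤ) (d : ℕ) : Submodule ℤ_[p] (Lau p) :=
  Submodule.span ℤ_[p] {f | ∃ k ∈ S, f = w p m d • LaurentPolynomial.T k}

theorem T_mem_lauSpan {S : Set ℤ} {k : ℤ} (hk : k ∈ S) (d : ℕ) :
    w p m d • (LaurentPolynomial.T k : Lau p) ∈ lauSpan p m S d :=
  Submodule.subset_span ⟨k, hk, rfl⟩

theorem lauSpan_mul {S S' S'' : Set ℤ} (hS : ∀ k ∈ S, ∀ l ∈ S', k + l ∈ S'') {i j : ℕ} {f g : Lau p}
    (hf : f ∈ lauSpan p m S i) (hg : g ∈ lauSpan p m S' j) : f * g ∈ lauSpan p m S'' (i + j) := by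
  refine mul_mem_of_span ?_ hf hg
  rintro _ ⟨k, hk, rfl⟩ _ ⟨l, hl, rfl⟩
  rw [smul_mul_smul_comm, ← LaurentPolynomial.T_add, smul_smul_div]
  exact smul_mem_of_norm_le (T_mem_lauSpan p m (hS k hk l hl) _) (norm_w_mul_le p m i j)

theorem coeffL_smulZ (k : ℤ) (c : ℤ_[p]) (f : Lau p) :
    coeffL p k (c • f) = (c : ℚ_[p]) * coeffL p k f := by
  rw [← algebraMap_smul ℚ_[p] c f, map_smul]; rfl

theorem sum_coeffL (f : Lau p) :
    ∑ k ∈ ((monoBasis p).repr f).support, coeffL p k f • (LaurentPolynomial.T k : Lau p) = f := by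
  conv_rhs => rw [← (monoBasis p).linearCombination_repr f]
  rw [Finsupp.linearCombination_apply, Finsupp.sum]
  rfl

/-- The lattice is spanned by multiples of a monomial basis, so membership can be tested coefficient
by coefficient. The bound and the support are independent conditions, which makes intersections over
different `S` immediate. -/
theorem mem_lauSpan_iff {S : Set ℤ} {d : ℕ} {f : Lau p} :
    f ∈ lauSpan p m S d ↔ (∀ k, ‖coeffL p k f‖ ≤ ‖w p m d‖) ∧ ∀ k ∉ S, coeffL p k f = 0 := by
  constructor
  · intro hf
    refine Submodule.span_induction (p := fun f _ =>
      (∀ k, ‖coeffL p k f‖ ≤ ‖w p m d‖) ∧ ∀ k ∉ S, coeffL p k f = 0) ?_ ?_ ?_ ?_ hf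
    · rintro _ ⟨k, hk, rfl⟩
      refine ⟨fun l => ?_, fun l hl => ?_⟩
      · rw [map_smul, coeffL_T]
        split_ifs <;> simp
      · rw [map_smul, coeffL_T, if_neg (by rintro rfl; exact hl hk), smul_zero]
    · simp
    · rintro f g _ _ ⟨h1, h2⟩ ⟨h3, h4⟩
      refine ⟨fun k => ?_, fun k hk => ?_⟩
      · rw [map_add]
        exact (Padic.nonarchimedean _ _).trans (max_le (h1 k) (h3 k))
      · rw [map_add, h2 k hk, h4 k hk, add_zero]
    · rintro c f _ ⟨h1, h2⟩
      refine ⟨fun k => ?_, fun k hk => ?_⟩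
      · rw [coeffL_smulZ, norm_mul]
        exact (mul_le_of_le_one_left (norm_nonneg _) c.2).trans (h1 k)
      · rw [coeffL_smulZ, h2 k hk, mul_zero]
  · rintro ⟨h1, h2⟩
    rw [← sum_coeffL p f]
    refine sum_mem fun k _ => ?_
    by_cases hk : k ∈ S
    · have e : coeffL p k f • (LaurentPolynomial.T k : Lau p) =
          (coeffL p k f / w p m d) • w p m d • LaurentPolynomial.T k := by
        rw [smul_smul, div_mul_cancel₀ _ (w_ne p m d)]
      rw [e]
      refine smul_mem_of_norm_le (T_mem_lauSpan p m hk d) ?_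
      rw [norm_div]
      exact div_le_one_of_le₀ (h1 k) (norm_nonneg _)
    · rw [h2 k hk, zero_smul]; exact zero_mem _

theorem mem_lauSpan_inter {S S' : Set ℤ} {d : ℕ} {f : Lau p} (h : f ∈ lauSpan p m S d)
    (h' : f ∈ lauSpan p m S' d) : f ∈ lauSpan p m (S ∩ S') d := by
  rw [mem_lauSpan_iff] at *
  refine ⟨h.1, fun k hk => ?_⟩
  by_cases hS : k ∈ S
  · exact h'.2 k fun hS' => hk ⟨hS, hS'⟩
  · exact h.2 k hS

theorem one_mem_lauSpan {S : Set ℤ} (h : 0 ∈ S) : (1 : Lau p) ∈ lauSpan p m S 0 := by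
  simpa [w_zero] using T_mem_lauSpan p m h 0

end LaurentLattices

/-! ### Bounding the global sections of `Sym(𝒯)^{(m)}` -/

section SymSections

variable (p : ℕ) [hp : Fact p.Prime] (m : ℕ)

/-- The graded subalgebra `⨁_d L_d ∂_x^d`, where `L_d` is the lattice spanned by
`(q_d! / d!) x^k`, `k ∈ S d`. -/
def gradedLattice (S : ℕ → Set ℤ) (h0 : 0 ∈ S 0)
    (hS : ∀ i j, ∀ k ∈ S i, ∀ l ∈ S j, k + l ∈ S (i + j)) : Subalgebra ℤ_[p] (SymRing p) where
  carrier := {z | ∀ d, z.coeff d ∈ lauSpan p m (S d) d}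
  mul_mem' := by
    intro z z' hz hz' d
    rw [Polynomial.coeff_mul]
    refine sum_mem fun ij hij => ?_
    have e : ij.1 + ij.2 = d := by simpa using hij
    rw [← e]
    exact lauSpan_mul p m (hS _ _) (hz _) (hz' _)
  add_mem' := by
    intro z z' hz hz' d
    rw [Polynomial.coeff_add]
    exact add_mem (hz d) (hz' d)
  algebraMap_mem' := by
    intro c d
    rw [Algebra.algebraMap_eq_smul_one, Polynomial.coeff_smul, Polynomial.coeff_one]
    refine Submodule.smul_mem _ _ ?_
    split_ifs with h
    · rw [h]; exact one_mem_lauSpan p m h0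
    · exact zero_mem _

/-- In rank one `(g s)^i = g^i s^i`, so the divided powers of an arbitrary section `g s` reduce to
those of the generator `s = v ∂_x`. It is then enough to check the coordinate and the elements `w_i
v^i`. -/
theorem symChart_le_gradedLattice {S : ℕ → Set ℤ} (h0 : 0 ∈ S 0)
    (hS : ∀ i j, ∀ k ∈ S i, ∀ l ∈ S j, k + l ∈ S (i + j)) {u v : Lau p}
    (hu : u ∈ lauSpan p m (S 0) 0) (hv : ∀ i, w p m i • v ^ i ∈ lauSpan p m (S i) i) :
    symChart p m (Polynomial.C u) (Polynomial.C v * Polynomial.X) ≤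
      gradedLattice p m S h0 hS := by
  have ht : Polynomial.C u ∈ gradedLattice p m S h0 hS := by
    intro d
    rw [Polynomial.coeff_C]
    split_ifs with h
    · rw [h]; exact hu
    · exact zero_mem _
  refine Algebra.adjoin_le ?_
  rintro _ (rfl | ⟨g, hg, i, rfl⟩)
  · exact ht
  · have hg' : g ∈ gradedLattice p m S h0 hS :=
      Algebra.adjoin_le (Set.singleton_subset_iff.2 ht) hg
    rw [mul_pow, ← mul_smul_comm]
    refine mul_mem (pow_mem hg' i) fun d => ?_
    rw [mul_pow, ← map_pow, Polynomial.C_mul_X_pow_eq_monomial, Polynomial.smul_monomial,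
      Polynomial.coeff_monomial]
    split_ifs with h
    · rw [← h]; exact hv i
    · exact zero_mem _

theorem smul_neg_T_two_pow (i : ℕ) (c : ℚ_[p]) : c • (-LaurentPolynomial.T 2 : Lau p) ^ i =
    (c * (-1) ^ i) • LaurentPolynomial.T (2 * i) := by
  rw [neg_pow, LaurentPolynomial.T_pow, mul_smul, mul_comm (i : ℤ)]
  congr 1
  rcases Nat.even_or_odd i with h | h <;> simp [h.neg_one_pow]

/-- The exponents `0 ≤ k ≤ 2 d` of the sections `x^k ∂_x^d` of `𝒯^{⊗ d}` over `ℙ¹`. -/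
def globalExp (d : ℕ) : Set ℤ := {k | 0 ≤ k} ∩ {k | k ≤ 2 * d}

/-- The chart `U_x` forces exponents `k ≥ 0`, and the chart `U_y`, where `∂_y^d` has symbol
`(-x²)^d` and coefficients are polynomials in `x⁻¹`, forces `k ≤ 2d`. Both carry the same weight
`w_d`, so the two lattices intersect in the expected copy of `H⁰(𝒪(2d))`. -/
theorem H0Sym_coeff {z : SymRing p} (hz : z ∈ H0Sym p m) (d : ℕ) :
    z.coeff d ∈ lauSpan p m (globalExp d) d := by
  obtain ⟨hx, hy⟩ := Algebra.mem_inf.1 hz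
  refine mem_lauSpan_inter p m ?_ ?_
  · have h := symChart_le_gradedLattice p m (S := fun _ => {k : ℤ | 0 ≤ k}) (by simp)
      (fun _ _ k hk l hl => by simp only [Set.mem_ofPred_eq] at *; exact add_nonneg hk hl) (u := LaurentPolynomial.T 1) (v := 1)
      (by simpa [w_zero] using T_mem_lauSpan p m (S := {k : ℤ | 0 ≤ k}) (k := 1) (by simp) 0)
      (fun i => by
        rw [one_pow]
        exact T_mem_lauSpan p m (S := {k : ℤ | 0 ≤ k}) (k := 0) (by simp) i)
    rw [Polynomial.C_1, one_mul] at h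
    exact h hx d
  · refine symChart_le_gradedLattice p m (S := fun d => {k : ℤ | k ≤ 2 * d})
      (by simp) (fun i j k hk l hl => ?_) ?_ (fun i => ?_) hy d
    · simp only [Set.mem_ofPred_eq] at *
      push_cast
      linarith
    · simpa [w_zero] using T_mem_lauSpan p m (S := {k : ℤ | k ≤ 2 * (0 : ℕ)}) (k := -1) (by simp) 0
    · have hT := T_mem_lauSpan p m (S := {k : ℤ | k ≤ 2 * (i : ℕ)}) (k := 2 * i) (by simp) i
      rw [smul_neg_T_two_pow, mul_comm (w p m i), mul_smul]
      exact smul_mem_of_norm_le hT (c := (-1) ^ i) (by simp)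

end SymSections

/-! ### Global operators with prescribed principal symbol -/

section Lifts

variable (p : ℕ) [hp : Fact p.Prime] (m : ℕ)

theorem symb_mem_lauSpan {d : ℕ} {P : Op p} (h : P ∈ (H0DFil p m).F d) :
    symb p d P ∈ lauSpan p m (globalExp d) d := by
  have := H0Sym_coeff p m (H0DFil_monomial p m h) d
  rwa [Polynomial.coeff_monomial, if_pos rfl] at this

theorem xOp_mul_yOp : xOp p * yOp p = 1 := op_ext fun n => by
  rw [Module.End.mul_apply, yOp_T, xOp_T, sub_add_cancel, Module.End.one_apply]

theorem yOp_mul_xOp : yOp p * xOp p = 1 := op_ext fun n => by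
  rw [Module.End.mul_apply, xOp_T, yOp_T, add_sub_cancel_right, Module.End.one_apply]

/-- Since `(t² δ)^d = t^d ff(tδ + d - 1, d)`, the factor `s^k = t^{-k}` with `k ≤ d` only cancels
part of `t^d`, leaving `t^{d-k}` times a weighted falling factorial. Applied to `t = y`, `s = x` it
shows that `x^k w_d ∂_x^d` has no pole on `U_y`, and symmetrically with the charts exchanged. -/
theorem inv_pow_mul_smul_sq_pow_mem {A : Type*} [Ring A] [Algebra ℚ_[p] A] [Algebra ℤ_[p] A]
    [IsScalarTower ℤ_[p] ℚ_[p] A] {s t δ : A} (ht : δ * t = t * δ + 1) (hs : s * t = 1) {k d : ℕ}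
    (hk : k ≤ d) : s ^ k * (w p m d • (-(t * t * δ)) ^ d) ∈ chartSpan p m t δ d := by
  have hst : ∀ k, s ^ k * t ^ k = 1 := by
    intro k
    induction k with
    | zero => simp
    | succ k ih => rw [pow_succ, pow_succ', mul_assoc, ← mul_assoc s, hs, one_mul, ih]
  -- The span of the weighted falling factorials of `tδ` is invariant under the integer shift by `d
  -- - 1`.
  have h2 : w p m d • ff (t * δ + d - 1) d ∈ ffSpan p m (t * δ) d := by
    rw [← ffSpan_add_int p m (t * δ) (d - 1)]
    have e : t * δ + d - 1 = t * δ + ((d - 1 : ℤ) : A) := by push_cast; abel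
    rw [e]
    exact ff_mem_ffSpan p m _ le_rfl
  have h3 := chartSpan_mul p m ht (i := 0) (j := d) (x := t ^ (d - k))
    (by simpa [w_zero] using chart_mem p m t δ (i := d - k) (le_refl 0))
    (ffSpan_euler_le p m ht d h2)
  have h1 : s ^ k * (w p m d • (t * t * δ) ^ d) ∈ chartSpan p m t δ d := by
    rw [zero_add] at h3
    rw [sq_pow ht, mul_smul_comm, ← mul_assoc]
    obtain ⟨l, rfl⟩ := Nat.exists_eq_add_of_le hk
    rw [pow_add t k, ← mul_assoc, hst, one_mul, ← mul_smul_comm]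
    rwa [Nat.add_sub_cancel_left] at h3
  rcases neg_one_pow_eq_or A d with e | e <;> rw [neg_pow, e]
  · simpa using h1
  · simpa using neg_mem h1

/-- An operator `x^k w_d ∂_x^d` is global at level `m` for `k ≤ d`, which covers half of the range
`0 ≤ k ≤ 2d`. The other half comes from exchanging the charts, where `x^k ∂_x^d` becomes `± y^{2d-k}
∂_y^d` at the level of symbols. -/
theorem exists_symb_eq_T {d : ℕ} {k : ℤ} (hk : k ∈ globalExp d) :
    ∃ Q ∈ (H0DFil p m).F d, symb p d Q = w p m d • LaurentPolynomial.T k := by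
  obtain ⟨h0, h1⟩ := hk
  simp only [Set.mem_ofPred_eq] at h0 h1
  obtain ⟨n, rfl⟩ := Int.eq_ofNat_of_zero_le h0
  by_cases hn : n ≤ d
  · refine ⟨xOp p ^ n * (w p m d • dx p ^ d), ⟨chart_mem p m _ _ le_rfl, ?_⟩, ?_⟩
    · rw [dx_eq]
      exact inv_pow_mul_smul_sq_pow_mem p m (dy_mul_yOp p) (xOp_mul_yOp p) hn
    · rw [(chart_symb p m (x_data p) (dx_data p) n d).2, LaurentPolynomial.T_pow]
      simp
  -- Here `l = 2d - n < d`, so the cancellation works on `U_x`. The sign `(-1)^d` in the witness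
  -- undoes the one in the symbol `(-x²)^d` of `∂_y^d`.
  · obtain ⟨l, hl⟩ : ∃ l, l + n = 2 * d := ⟨2 * d - n, by omega⟩
    have hmem : yOp p ^ l * (w p m d • dy p ^ d) ∈ (H0DFil p m).F d := by
      refine ⟨?_, chart_mem p m _ _ le_rfl⟩
      exact inv_pow_mul_smul_sq_pow_mem p m (dx_mul_xOp p) (yOp_mul_xOp p) (by omega)
    refine ⟨((-1) ^ d : ℚ_[p]) • (yOp p ^ l * (w p m d • dy p ^ d)),
      smul_mem_of_norm_le hmem (by simp), ?_⟩
    rw [map_smul, (chart_symb p m (y_data p) (dy_data p) l d).2, smul_neg_T_two_pow,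
      mul_smul_comm, LaurentPolynomial.T_pow, ← LaurentPolynomial.T_add, smul_smul]
    congr 1
    · rw [mul_left_comm, ← mul_pow]; simp
    · congr 1
      have : (l : ℤ) + n = 2 * d := by exact_mod_cast hl
      linarith

theorem exists_symb_eq {d : ℕ} {f : Lau p} (hf : f ∈ lauSpan p m (globalExp d) d) :
    ∃ Q ∈ (H0DFil p m).F d, symb p d Q = f := by
  refine Submodule.span_induction (p := fun f _ => ∃ Q ∈ (H0DFil p m).F d, symb p d Q = f)
    ?_ ?_ ?_ ?_ hf
  · rintro _ ⟨k, hk, rfl⟩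
    exact exists_symb_eq_T p m hk
  · exact ⟨0, zero_mem _, map_zero _⟩
  · rintro _ _ _ _ ⟨P, hP, rfl⟩ ⟨Q, hQ, rfl⟩
    exact ⟨P + Q, add_mem hP hQ, map_add _ _ _⟩
  · rintro c _ _ ⟨P, hP, rfl⟩
    refine ⟨c • P, Submodule.smul_mem _ _ hP, ?_⟩
    rw [← algebraMap_smul ℚ_[p] c P, map_smul, algebraMap_smul]

end Lifts

/-! ### The symbol map is an isomorphism -/

section SymbolBijective

variable (p : ℕ) [hp : Fact p.Prime] (m : ℕ)

/-- Sections of order `< d` over a chart. -/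
def chartPred (t δ : Op p) : ℕ → Submodule ℤ_[p] (Op p)
  | 0 => ⊥
  | d + 1 => chartSpan p m t δ d

/-- This isolates the coefficient of `w_d δ^d`, keeping the remainder integral at level `m`; knowing
only that the remainder has order `< d` rationally would not suffice for injectivity. -/
theorem chart_leading_term {t δ : Op p} {d : ℕ} {P : Op p} (hP : P ∈ chartSpan p m t δ d) :
    ∃ G ∈ Submodule.span ℤ_[p] (Set.range fun i : ℕ => t ^ i),
      P - G * (w p m d • δ ^ d) ∈ chartPred p m t δ d := by
  refine Submodule.span_induction (p := fun P _ =>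
    ∃ G ∈ Submodule.span ℤ_[p] (Set.range fun i : ℕ => t ^ i),
      P - G * (w p m d • δ ^ d) ∈ chartPred p m t δ d) ?_ ?_ ?_ ?_ hP
  · rintro _ ⟨i, a, ha, rfl⟩
    rcases ha.lt_or_eq with h | rfl
    · refine ⟨0, zero_mem _, ?_⟩
      obtain ⟨d, rfl⟩ : ∃ d', d = d' + 1 := ⟨d - 1, by omega⟩
      rw [zero_mul, sub_zero]
      exact chart_mem p m t δ (Nat.lt_succ_iff.1 h)
    · exact ⟨t ^ i, Submodule.subset_span ⟨i, rfl⟩, by rw [sub_self]; exact zero_mem _⟩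
  · exact ⟨0, zero_mem _, by simp⟩
  · rintro P Q _ _ ⟨G, hG, h⟩ ⟨G', hG', h'⟩
    refine ⟨G + G', add_mem hG hG', ?_⟩
    rw [add_mul, add_sub_add_comm]
    exact add_mem h h'
  · rintro c P _ ⟨G, hG, h⟩
    refine ⟨c • G, Submodule.smul_mem _ _ hG, ?_⟩
    rw [smul_mul_assoc, ← smul_sub]
    exact Submodule.smul_mem _ _ h

/-- The symbol of `P` is that of its leading coefficient `G` times `w_d v^d`. Laurent polynomials
form a domain and `v ≠ 0`, so the symbol of `G` vanishes. As `G` commutes with `x`, it is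
multiplication by `G 1`, hence zero, and `P` equals its lower-order remainder. -/
theorem chart_mem_pred {t δ : Op p} {u v : Lau p} (h1 : t ∈ ordLE p 0 ∧ symb p 0 t = u)
    (h2 : δ ∈ ordLE p 1 ∧ symb p 1 δ = v) (hv : v ≠ 0) {d : ℕ} {P : Op p}
    (hP : P ∈ chartSpan p m t δ d) (h0 : symb p d P = 0) : P ∈ chartPred p m t δ d := by
  obtain ⟨G, hG, h⟩ := chart_leading_term p m hP
  have hG0 : G ∈ ordLE p 0 := by
    have hle : Submodule.span ℤ_[p] (Set.range fun i : ℕ => t ^ i) ≤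
        (ordLE p 0).restrictScalars ℤ_[p] := by
      rw [Submodule.span_le]
      rintro _ ⟨i, rfl⟩
      exact (ord_symb_pow_zero p h1.1 h1.2 i).1
    exact hle hG
  obtain ⟨h5, h6⟩ := ord_symb_pow p h2.1 h2.2 d
  have hs : symb p d (G * (w p m d • δ ^ d)) = symb p 0 G * (w p m d • v ^ d) := by
    have := symb_mul p hG0 (Submodule.smul_mem _ (w p m d) h5)
    rwa [zero_add, map_smul, h6] at this
  have hlow : symb p d (P - G * (w p m d • δ ^ d)) = 0 := by
    rcases d with _ | d
    · have : P - G * (w p m 0 • δ ^ 0) = 0 := by simpa [chartPred] using h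
      rw [this, map_zero]
    · exact symb_eq_zero p (chartSpan_le_ordLE p m h1 h2 d h) d.lt_succ_self
  rw [map_sub, h0, zero_sub, neg_eq_zero, hs] at hlow
  have hG1 : G 1 = 0 := by
    have h7 : symb p 0 G = 0 := (mul_eq_zero.1 hlow).resolve_right
      (smul_ne_zero (w_ne p m d) (pow_ne_zero d hv))
    simpa [symb_apply] using h7
  have hG2 : G = 0 := by
    ext1 f
    exact LinearMap.ext fun g => by
      rw [LinearMap.comp_apply, LinearMap.comp_apply,
        commute_x_apply p (adx_zero_of_mem p hG0), hG1, zero_mul, LinearMap.zero_apply]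
  rwa [hG2, zero_mul, sub_zero] at h

/-- The kernel of the symbol of order `d` is the previous filtration step. The order drops on each
chart separately, and a global section of order `< d` is precisely a pair of such chart sections
that agree. -/
theorem H0DFil_mem_pred {d : ℕ} {P : Op p} (hP : P ∈ (H0DFil p m).F d) (h0 : symb p d P = 0) :
    P ∈ (H0DFil p m).pred d := by
  have hx := chart_mem_pred p m (x_data p) (dx_data p) one_ne_zero (H0DFil_x p m hP) h0
  have hy := chart_mem_pred p m (y_data p) (dy_data p)
    (neg_ne_zero.2 (LaurentPolynomial.isUnit_T 2).ne_zero) (H0DFil_y p m hP) h0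
  rcases d with _ | d
  · exact hx
  · exact ⟨hx, hy⟩

theorem symbolMap_injective : Function.Injective (symbolMap p m) := by
  rw [injective_iff_map_eq_zero]
  intro a ha
  obtain ⟨P, rfl⟩ := Ideal.Quotient.mk_surjective a
  refine Ideal.Quotient.eq_zero_iff_mem.2 fun d => H0DFil_mem_pred p m (P.2 d) ?_
  rw [← symbPoly_coeff]
  exact congrArg (fun z : H0Sym p m => z.1.coeff d) ha

theorem symbolMap_surjective : Function.Surjective (symbolMap p m) := by
  intro z
  choose Q hQ hs using fun d => exists_symb_eq p m (H0Sym_coeff p m z.2 d)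
  -- The lifts are cut off to the support of `z`: a chosen lift of the zero symbol need not be zero,
  -- and the formal sum has to be finite.
  let P : Polynomial (Op p) := ∑ d ∈ z.1.support, Polynomial.monomial d (Q d)
  have hc : ∀ d, P.coeff d = if d ∈ z.1.support then Q d else 0 := by
    intro d
    simp only [P, Polynomial.finsetSum_coeff, Polynomial.coeff_monomial, Finset.sum_ite_eq']
  have hP : P ∈ (H0DFil p m).rees := by
    intro d
    rw [hc]
    split_ifs
    · exact hQ d
    · exact zero_mem _
  refine ⟨Ideal.Quotient.mk _ ⟨P, hP⟩, Subtype.ext (Polynomial.ext fun d => ?_)⟩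
  change (symbPoly p P).coeff d = _
  rw [symbPoly_coeff, hc]
  split_ifs with h
  · exact hs d
  · rw [map_zero, Polynomial.notMem_support_iff.1 h]

theorem symbolMap_bijective : Function.Bijective (symbolMap p m) :=
  ⟨symbolMap_injective p m, symbolMap_surjective p m⟩

end SymbolBijective

/-! ### Finiteness over the graded ring -/

section GradedFiniteness

variable (p : ℕ) [hp : Fact p.Prime] (m : ℕ)

/-- The norm of `w_n` is `p` to the power `∑ ⌊n / p^{i+1}⌋` over `i < m`. Every `p^{i+1}` occurring
there divides `p^m`, so adding `p^m` to `n` produces no carries. This is the source of all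
finiteness below. -/
theorem norm_w_prime_pow_add (n : ℕ) : ‖w p m (p ^ m + n)‖ = ‖w p m (p ^ m)‖ * ‖w p m n‖ := by
  rw [norm_w, norm_w, norm_w, ← pow_add, ← Finset.sum_add_distrib]
  congr 1
  refine Finset.sum_congr rfl fun i hi => Nat.add_div_of_dvd_right ?_
  exact pow_dvd_pow p (Finset.mem_range.1 hi)

theorem smul_eU_pow_mem (n : ℕ) : w p m n • eU p ^ n ∈ (UmFil p m).F n :=
  Submodule.subset_span ⟨n, 0, 0, 0, by simp, by simp [pbw, ff_zero, w_zero]⟩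

theorem smul_fU_pow_mem (n : ℕ) : w p m n • fU p ^ n ∈ (UmFil p m).F n :=
  Submodule.subset_span ⟨0, 0, 0, n, by simp, by simp [pbw, ff_zero, w_zero]⟩

theorem symb_xiQ_eU_pow (n : ℕ) (c : ℚ_[p]) :
    symb p n (xiQ p (c • eU p ^ n)) = c • (LaurentPolynomial.T 0 : Lau p) := by
  rw [map_smul, map_pow, xiQ_e, map_smul, (ord_symb_pow p (dx_data p).1 (dx_data p).2 n).2,
    one_pow, LaurentPolynomial.T_zero]

theorem symb_xiQ_fU_pow (n : ℕ) (c : ℚ_[p]) :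
    symb p n (xiQ p (c • fU p ^ n)) = (c * (-1) ^ n) • (LaurentPolynomial.T (2 * n) : Lau p) := by
  rw [map_smul, map_pow, xiQ_f, map_smul, (ord_symb_pow p (dy_data p).1 (dy_data p).2 n).2,
    smul_neg_T_two_pow]

theorem mem_globalExp {k : ℤ} {d : ℕ} : k ∈ globalExp d ↔ 0 ≤ k ∧ k ≤ 2 * d := Iff.rfl

/-- Every symbol `(q_d! / d!) x^k ∂_x^d` of degree `d = p^m + n`, `n ≥ p^m`, is a multiple of such
a symbol of degree `n` by the symbol of an element of `U(𝔤_{ℤ_p})^{(m)}` of degree `p^m`. -/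
theorem exists_symb_mul_eq {n : ℕ} (hn : p ^ m ≤ n) {k : ℤ} (hk : k ∈ globalExp (p ^ m + n)) :
    ∃ u ∈ (UmFil p m).F (p ^ m), ∃ l ∈ globalExp n,
      symb p (p ^ m) (xiQ p u) * (w p m n • LaurentPolynomial.T l) =
        w p m (p ^ m + n) • LaurentPolynomial.T k := by
  set r : ℕ := p ^ m
  have hw := w_ne p m r
  have hw' := w_ne p m n
  -- The factor `c` has norm one; it corrects `w_r w_n` to `w_{r+n}` and may be absorbed into the
  -- element of `U(𝔤_{ℤ_p})^{(m)}`.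
  set c : ℚ_[p] := w p m (r + n) / (w p m r * w p m n) with hc
  have hc1 : ‖c‖ ≤ 1 := by
    rw [hc, norm_div, norm_mul, norm_w_prime_pow_add, div_self]
    exact mul_ne_zero (norm_ne_zero_iff.2 hw) (norm_ne_zero_iff.2 hw')
  have hcw : c * (w p m r * w p m n) = w p m (r + n) :=
    div_mul_cancel₀ _ (mul_ne_zero hw hw')
  rw [mem_globalExp] at hk
  push_cast at hk
  -- The symbol of `e^r` leaves the exponent unchanged and that of `f^r` shifts it by `2r`, so the
  -- reachable exponents are `[0, 2n]` and `[2r, 2r + 2n]`. These cover `[0, 2r + 2n]` because `n ≥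
  -- r`.
  by_cases hkr : k < 2 * r
  · refine ⟨c • w p m r • eU p ^ r, smul_mem_of_norm_le (smul_eU_pow_mem p m r) hc1, k,
      mem_globalExp.2 ⟨hk.1, by omega⟩, ?_⟩
    rw [smul_smul, symb_xiQ_eU_pow, smul_mul_smul_comm, ← LaurentPolynomial.T_add, zero_add,
      mul_assoc, hcw]
  -- The sign cancels against the symbol `(-x²)^r` of `∂_y^r`.
  · refine ⟨(c * (-1) ^ r) • w p m r • fU p ^ r,
      smul_mem_of_norm_le (smul_fU_pow_mem p m r) (by simpa using hc1), k - 2 * r,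
      mem_globalExp.2 ⟨by omega, by omega⟩, ?_⟩
    rw [smul_smul, symb_xiQ_fU_pow, smul_mul_smul_comm, ← LaurentPolynomial.T_add,
      add_sub_cancel, ← hcw]
    congr 1
    have h1 : ((-1) ^ r * (-1) ^ r : ℚ_[p]) = 1 := by rw [← mul_pow]; simp
    linear_combination (c * w p m r * w p m n) * h1

/-- The criterion asks only for additive submonoids stable under left multiplication. In this form
it can be checked after embedding `C` in a larger ring, here polynomials over Laurent polynomials or
operators. -/
theorem FiniteVia.of_closed {B C : Type*} [Semiring B] [Semiring C] (g : B →+* C) (S : Set C)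
    (hS : S.Finite) (h : ∀ N : AddSubmonoid C, S ⊆ N → (∀ b, ∀ x ∈ N, g b * x ∈ N) → ∀ x, x ∈ N) :
    FiniteVia g := by
  let _ : Module B C := Module.compHom C g
  refine ⟨(Submodule.fg_def).2 ⟨S, hS, ?_⟩⟩
  refine Submodule.eq_top_iff'.2 (h (Submodule.span B S).toAddSubmonoid Submodule.subset_span ?_)
  exact fun b x hx => (Submodule.span B S).smul_mem b hx

/-- Homogeneous elements: the class of `u t^d` in the graded ring acts as multiplication by the
symbol of order `d` of its image. -/
theorem exists_gr_symb {d : ℕ} {u : Ug p} (hu : u ∈ (UmFil p m).F d) :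
    ∃ b, (((symbolMap p m).comp (grXi p m)) b : SymRing p) =
      Polynomial.monomial d (symb p d (xiQ p u)) := by
  have hP : Polynomial.monomial d u ∈ (UmFil p m).rees := by
    intro i
    rw [Polynomial.coeff_monomial]
    split_ifs with h
    · rw [← h]; exact hu
    · exact zero_mem _
  refine ⟨Ideal.Quotient.mk _ ⟨Polynomial.monomial d u, hP⟩, Polynomial.ext fun i => ?_⟩
  change (symbPoly p (Polynomial.map (xiQ p).toRingHom (Polynomial.monomial d u))).coeff i = _
  rw [symbPoly_coeff, Polynomial.map_monomial, Polynomial.coeff_monomial, Polynomial.coeff_monomial]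
  split_ifs with h
  · rw [h]; rfl
  · rw [map_zero]

theorem algebraMap_mem_UmFil (c : ℤ_[p]) : algebraMap ℤ_[p] (Ug p) c ∈ (UmFil p m).F 0 := by
  rw [Algebra.algebraMap_eq_smul_one]
  exact Submodule.smul_mem _ _ (UmFil p m).one_mem

/-- The pairs `(d, k)` indexing the generators `(q_d! / d!) x^k ∂_x^d`. -/
def genIndex : Set (ℕ × ℤ) := {i | i.1 < 2 * p ^ m ∧ i.2 ∈ globalExp i.1}

theorem genIndex_finite (p m : ℕ) : (genIndex p m).Finite := by
  -- Degrees are below `2 p^m` and exponents are at most `2d`, hence at most `4 p^m`.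
  refine ((Set.finite_Iio (2 * p ^ m)).prod (Set.finite_Icc (0 : ℤ) (4 * p ^ m))).subset ?_
  rintro ⟨d, k⟩ ⟨hd, hk⟩
  rw [mem_globalExp] at hk
  refine ⟨hd, hk.1, hk.2.trans ?_⟩
  simp only at hd
  have : (d : ℤ) < 2 * (p : ℤ) ^ m := by exact_mod_cast hd
  change 2 * (d : ℤ) ≤ _
  linarith

/-- Strong induction on the degree: from `2 p^m` onwards a monomial is a multiple, by an element of
degree `p^m`, of one whose degree is lower by `p^m`. The remaining monomials are the generators. -/
theorem H0Sym_closed {N : AddSubmonoid (SymRing p)}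
    (hg : ∀ i ∈ genIndex p m, Polynomial.monomial i.1 (w p m i.1 • LaurentPolynomial.T i.2) ∈ N)
    (hN : ∀ b, ∀ x ∈ N, (((symbolMap p m).comp (grXi p m)) b : SymRing p) * x ∈ N)
    {z : SymRing p} (hz : z ∈ H0Sym p m) : z ∈ N := by
  have hT : ∀ d, ∀ k ∈ globalExp d,
      Polynomial.monomial d (w p m d • LaurentPolynomial.T k : Lau p) ∈ N := by
    intro d
    induction d using Nat.strong_induction_on with
    | _ d ih =>
      intro k hk
      by_cases hd : d < 2 * p ^ m
      · exact hg (d, k) ⟨hd, hk⟩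
      · obtain ⟨n, rfl⟩ : ∃ n, d = p ^ m + n := ⟨d - p ^ m, by omega⟩
        obtain ⟨u, hu, l, hl, e⟩ := exists_symb_mul_eq p m (by omega) hk
        obtain ⟨b, hb⟩ := exists_gr_symb p m hu
        rw [← e, ← Polynomial.monomial_mul_monomial, ← hb]
        have := pow_pos hp.out.pos m
        exact hN b _ (ih n (by omega) l hl)
  have hM : ∀ d, ∀ f ∈ lauSpan p m (globalExp d) d, Polynomial.monomial d f ∈ N := by
    intro d f hf
    refine Submodule.span_induction (p := fun f _ => Polynomial.monomial d f ∈ N) ?_ ?_ ?_ ?_ hf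
    · rintro _ ⟨k, hk, rfl⟩
      exact hT d k hk
    · rw [map_zero]; exact zero_mem _
    · intro f g _ _ h h'
      rw [map_add]; exact add_mem h h'
    -- `N` is only an additive submonoid, so stability under `ℤ_p` has to be read off from the
    -- scalars in degree `0` of `gr U(𝔤_{ℤ_p})^{(m)}`.
    · intro c f _ h
      obtain ⟨b, hb⟩ := exists_gr_symb p m (algebraMap_mem_UmFil p m c)
      have e : Polynomial.monomial d (c • f) = Polynomial.monomial 0 (symb p 0
          (xiQ p (algebraMap ℤ_[p] (Ug p) c))) * Polynomial.monomial d f := by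
        rw [Polynomial.monomial_mul_monomial, zero_add, Algebra.algebraMap_eq_smul_one, xiQ_smulZ,
          map_one, ← algebraMap_smul ℚ_[p] c (1 : Op p), (symb p 0).map_smul, (one_data p).2, smul_mul_assoc,
          one_mul, algebraMap_smul]
      rw [e, ← hb]
      exact hN b _ h
  rw [z.as_sum_support]
  exact sum_mem fun d _ => hM d _ (H0Sym_coeff p m hz d)

theorem monomial_mem_H0Sym {d : ℕ} {f : Lau p} (hf : f ∈ lauSpan p m (globalExp d) d) :
    Polynomial.monomial d f ∈ H0Sym p m := by
  obtain ⟨Q, hQ, rfl⟩ := exists_symb_eq p m hf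
  exact H0DFil_monomial p m hQ

/-- The generators are the monomials of degree below `2 p^m`; a submonoid of `H⁰` is tested through
its image in the ambient ring of symbols. -/
theorem finiteVia_grXi : FiniteVia ((symbolMap p m).comp (grXi p m)) := by
  let gen : genIndex p m → H0Sym p m := fun i =>
    ⟨_, monomial_mem_H0Sym p m (T_mem_lauSpan p m i.2.2 i.1.1)⟩
  have := (genIndex_finite p m).to_subtype
  refine FiniteVia.of_closed _ (Set.range gen) (Set.finite_range _) fun N hS hN x => ?_
  have hx := H0Sym_closed p m (N := N.map ((H0Sym p m).val : H0Sym p m →+ SymRing p))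
    (fun i hi => ⟨_, hS ⟨⟨i, hi⟩, rfl⟩, rfl⟩)
    (by
      rintro b _ ⟨y, hy, rfl⟩
      exact ⟨_, hN b y hy, rfl⟩) x.2
  obtain ⟨y, hy, e⟩ := hx
  rwa [← Subtype.ext e]

end GradedFiniteness

/-! ### Finiteness over the filtered ring -/

section FilteredFiniteness

variable (p : ℕ) [hp : Fact p.Prime] (m : ℕ)

theorem mem_of_mem_pred {N : AddSubmonoid (Op p)} {d : ℕ}
    (h : ∀ i < d, ∀ P ∈ (H0DFil p m).F i, P ∈ N) {P : Op p} (hP : P ∈ (H0DFil p m).pred d) :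
    P ∈ N := by
  rcases d with _ | d
  · have h0 : P = 0 := by simpa [RingFil.pred] using hP
    rw [h0]; exact zero_mem _
  · exact h d d.lt_succ_self _ hP

/-- To show that a submonoid contains all global operators it suffices to lift principal symbols,
since an operator of order `≤ d` is determined by its symbol up to operators of order `< d`. -/
theorem H0DFil_closed_of_symb {N : AddSubmonoid (Op p)}
    (h : ∀ d, (∀ i < d, ∀ P ∈ (H0DFil p m).F i, P ∈ N) →
      ∀ P ∈ (H0DFil p m).F d, ∃ Q ∈ (H0DFil p m).F d, Q ∈ N ∧ symb p d Q = symb p d P) (d : ℕ) :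
    ∀ P ∈ (H0DFil p m).F d, P ∈ N := by
  induction d using Nat.strong_induction_on with
  | _ d ih =>
    intro P hP
    obtain ⟨Q, hQ, hQN, e⟩ := h d ih P hP
    have h1 := H0DFil_mem_pred p m (sub_mem hP hQ) (by rw [map_sub, e, sub_self])
    rw [← sub_add_cancel P Q]
    exact add_mem (mem_of_mem_pred p m ih h1) hQN

/-- This is the passage from graded to filtered generation. Modulo operators of lower order, which
lie in `N` by induction, only the symbol matters. In degree `≥ 2 p^m` the symbol is realised by `xiQ
p u * Q`, where `Q` has order lower by `p^m` and so already lies in `N`. -/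
theorem H0D_closed {g : genIndex p m → Op p} (hF : ∀ i, g i ∈ (H0DFil p m).F i.1.1)
    (hs : ∀ i, symb p i.1.1 (g i) = w p m i.1.1 • LaurentPolynomial.T i.1.2)
    {N : AddSubmonoid (Op p)} (hg : ∀ i, g i ∈ N)
    (hN : ∀ u ∈ Um p m, ∀ x ∈ N, xiQ p u * x ∈ N) (d : ℕ) : ∀ P ∈ (H0DFil p m).F d, P ∈ N := by
  refine H0DFil_closed_of_symb p m (fun d ih P hP => ?_) d
  refine Submodule.span_induction (p := fun f _ =>
    ∃ Q ∈ (H0DFil p m).F d, Q ∈ N ∧ symb p d Q = f) ?_ ?_ ?_ ?_ (symb_mem_lauSpan p m hP)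
  · rintro _ ⟨k, hk, rfl⟩
    by_cases hd : d < 2 * p ^ m
    · let i : genIndex p m := ⟨(d, k), hd, hk⟩
      exact ⟨g i, hF i, hg i, hs i⟩
    · obtain ⟨n, rfl⟩ : ∃ n, d = p ^ m + n := ⟨d - p ^ m, by omega⟩
      obtain ⟨u, hu, l, hl, e⟩ := exists_symb_mul_eq p m (by omega) hk
      obtain ⟨Q, hQ, hQs⟩ := exists_symb_eq_T p m hl
      have := pow_pos hp.out.pos m
      have hu' := xiQ_mem p m _ u hu
      refine ⟨xiQ p u * Q, (H0DFil p m).mul_mem hu' hQ, hN u ⟨_, hu⟩ Q (ih n (by omega) Q hQ), ?_⟩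
      rw [symb_mul p (H0DFil_ord p m hu') (H0DFil_ord p m hQ), hQs, e]
  · exact ⟨0, zero_mem _, zero_mem _, map_zero _⟩
  · rintro _ _ _ _ ⟨P, hP, hP', rfl⟩ ⟨Q, hQ, hQ', rfl⟩
    exact ⟨P + Q, add_mem hP hQ, add_mem hP' hQ', map_add _ _ _⟩
  · rintro c _ _ ⟨P, hP, hP', rfl⟩
    refine ⟨c • P, Submodule.smul_mem _ _ hP, ?_, ?_⟩
    -- Again the scalar `c` acts through its image in `U(𝔤_{ℤ_p})^{(m)}`.
    · have := hN _ ⟨0, algebraMap_mem_UmFil p m c⟩ P hP'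
      rwa [Algebra.algebraMap_eq_smul_one, xiQ_smulZ, map_one, smul_mul_assoc, one_mul] at this
    · rw [← algebraMap_smul ℚ_[p] c P, map_smul, algebraMap_smul]

/-- Finite generation is recorded over `U(𝔤_{ℤ_p})^{(m)}` itself, with the set made explicit: it
yields both the finiteness over the quotient at `θ₀` and the uniform exponent for the cokernel. -/
theorem H0D_generated : ∃ S : Set (H0D p m), S.Finite ∧ ∀ N : AddSubmonoid (H0D p m), S ⊆ N →
    (∀ u, ∀ x ∈ N, xi p m u * x ∈ N) → ∀ x, x ∈ N := by
  choose g hF hs using fun i : genIndex p m => exists_symb_eq_T p m i.2.2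
  have := (genIndex_finite p m).to_subtype
  refine ⟨Set.range fun i => ⟨g i, (mem_H0D_iff p m).2 ⟨_, hF i⟩⟩, Set.finite_range _,
    fun N hS hN x => ?_⟩
  obtain ⟨d, hd⟩ := (mem_H0D_iff p m).1 x.2
  obtain ⟨y, hy, e⟩ := H0D_closed p m hF hs
    (N := N.map ((H0D p m).val : H0D p m →+ Op p)) (fun i => ⟨_, hS ⟨i, rfl⟩, rfl⟩)
    (by
      rintro u hu _ ⟨y, hy, rfl⟩
      exact ⟨_, hN ⟨u, hu⟩ y hy, rfl⟩) d x.1 hd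
  rwa [← Subtype.ext e]

theorem xi0_tmul_one (u : Um p m) : xi0 p m (u ⊗ₜ 1) = xi p m u := by
  have h : xi0 p m (u ⊗ₜ 1) = xi p m u * scalarZg p m 1 :=
    Algebra.TensorProduct.lift_tmul _ _ _ _ _
  rw [h, map_one, mul_one]

/-- Stability under `ξ₀` implies stability under `ξ`, since `ξ(u) = ξ₀(u ⊗ 1)`; the same generators
therefore work. -/
theorem finiteVia_xi0 : FiniteVia (xi0 p m).toRingHom := by
  obtain ⟨S, hS, h⟩ := H0D_generated p m
  refine FiniteVia.of_closed _ S hS fun N hSN hN => h N hSN fun u x hx => ?_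
  rw [← xi0_tmul_one]
  exact hN _ x hx

end FilteredFiniteness

/-! ### The cokernel is killed by a power of `p` -/

section Cokernel

variable (p : ℕ) [hp : Fact p.Prime] (m : ℕ)

/-- The image of `U(𝔤_{ℤ_p})^{(m)}` in the ring of operators. -/
def xiRange : Subalgebra ℤ_[p] (Op p) where
  carrier := {P | ∃ u ∈ Um p m, xiQ p u = P}
  mul_mem' := by
    rintro _ _ ⟨u, hu, rfl⟩ ⟨v, hv, rfl⟩
    exact ⟨u * v, mul_mem hu hv, map_mul _ _ _⟩
  add_mem' := by
    rintro _ _ ⟨u, hu, rfl⟩ ⟨v, hv, rfl⟩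
    exact ⟨u + v, add_mem hu hv, map_add _ _ _⟩
  algebraMap_mem' c := ⟨algebraMap _ _ c, Subalgebra.algebraMap_mem _ c,
    (xiQ p).commutes (algebraMap ℤ_[p] ℚ_[p] c)⟩

/-- The operators `P` such that `p^N P` lies in the image of `U(𝔤_{ℤ_p})^{(m)}` for some `N`. -/
def xiSaturation : Submodule ℤ_[p] (Op p) where
  carrier := {P | ∃ N : ℕ, p ^ N • P ∈ xiRange p m}
  zero_mem' := ⟨0, by rw [smul_zero]; exact zero_mem _⟩
  add_mem' := by
    rintro P Q ⟨i, hi⟩ ⟨j, hj⟩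
    refine ⟨i + j, ?_⟩
    rw [smul_add, pow_add]
    refine add_mem ?_ ?_
    · rw [mul_comm, mul_smul]; exact nsmul_mem hi _
    · rw [mul_smul]; exact nsmul_mem hj _
  smul_mem' := by
    rintro c P ⟨i, hi⟩
    exact ⟨i, by rw [smul_comm]; exact Subalgebra.smul_mem _ hi c⟩

theorem exists_pow_norm_le (c : ℚ_[p]) : ∃ N : ℕ, ‖(p ^ N : ℚ_[p]) * c‖ ≤ 1 := by
  have h1 : (1 : ℝ) < p := by exact_mod_cast hp.out.one_lt
  obtain ⟨N, hN⟩ := pow_unbounded_of_one_lt ‖c‖ h1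
  refine ⟨N, ?_⟩
  rw [norm_mul, norm_pow, Padic.norm_p, inv_pow, inv_mul_le_one₀ (by positivity)]
  exact hN.le

/-- The symbol `x^k ∂_x^d`, `0 ≤ k ≤ 2 d`, comes from a monomial in `e, h₂, f`. -/
theorem exists_xiQ_symb_eq_T {d : ℕ} {k : ℤ} (hk : k ∈ globalExp d) :
    ∃ P ∈ (H0DFil p m).F d, P ∈ xiRange p m ∧ symb p d P = LaurentPolynomial.T k := by
  obtain ⟨h0, h1⟩ := mem_globalExp.1 hk
  obtain ⟨n, rfl⟩ := Int.eq_ofNat_of_zero_le h0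
  have he : eU p ∈ (UmFil p m).F 1 := by simpa [w_one] using smul_eU_pow_mem p m 1
  have hf : fU p ∈ (UmFil p m).F 1 := by simpa [w_one] using smul_fU_pow_mem p m 1
  have hh : h₂U p ∈ (UmFil p m).F 1 :=
    Submodule.subset_span ⟨0, 0, 1, 0, by simp, by simp [pbw, ff_zero, ff_one, w_zero, w_one]⟩
  have hpow : ∀ {u : Ug p}, u ∈ (UmFil p m).F 1 → ∀ i, u ^ i ∈ (UmFil p m).F i := by
    intro u hu i
    induction i with
    | zero => rw [pow_zero]; exact (UmFil p m).one_mem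
    | succ i ih => rw [pow_succ]; exact (UmFil p m).mul_mem ih hu
  have hE : xOp p * dx p ∈ ordLE p 1 ∧ symb p 1 (xOp p * dx p) = LaurentPolynomial.T 1 := by
    have := chart_symb p m (x_data p) (dx_data p) 1 1
    simpa [w_one] using this
  have hF := dy_data p
  -- The symbols of `e, h₂, f` are `1, x, -x²` times `∂_x`, so `e^a h₂^b f^c` contributes
  -- `x^{b+2c}`. Taking as many `f` as possible, and one `h₂` when `n` is odd, uses at most `d`
  -- factors because `n ≤ 2d`; powers of `e` fill up the degree.
  obtain ⟨a, b, c, rfl, hn⟩ : ∃ a b c, d = a + b + c ∧ n = b + 2 * c :=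
    ⟨d - n % 2 - n / 2, n % 2, n / 2, by omega, by omega⟩
  -- The scalar `(-1)^c` cancels the sign of `(-x²)^c`.
  have hu : (-1 : ℤ_[p]) ^ c • (eU p ^ a * h₂U p ^ b * fU p ^ c) ∈ (UmFil p m).F (a + b + c) :=
    Submodule.smul_mem _ _ ((UmFil p m).mul_mem ((UmFil p m).mul_mem (hpow he a) (hpow hh b))
      (hpow hf c))
  refine ⟨_, xiQ_mem p m _ _ hu, ⟨_, ⟨_, hu⟩, rfl⟩, ?_⟩
  rw [xiQ_smulZ, map_mul, map_mul, map_pow, map_pow, map_pow, xiQ_e, xiQ_h₂, xiQ_f,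
    ← algebraMap_smul ℚ_[p], map_smul]
  obtain ⟨h3, h4⟩ := ord_symb_pow p (dx_data p).1 (dx_data p).2 a
  obtain ⟨h5, h6⟩ := ord_symb_pow p hE.1 hE.2 b
  obtain ⟨h7, h8⟩ := ord_symb_pow p hF.1 hF.2 c
  have h9 := smul_neg_T_two_pow p c ((-1) ^ c)
  rw [← mul_pow, neg_one_mul, neg_neg, one_pow, one_smul] at h9
  rw [symb_mul p (ord_mul p h3 h5) h7, symb_mul p h3 h5, h4, h6, h8, one_pow, one_mul,
    ← mul_smul_comm, map_pow, map_neg, map_one, h9, LaurentPolynomial.T_pow,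
    ← LaurentPolynomial.T_add, hn]
  congr 1
  push_cast
  ring

/-- The weight `w_d` is the only obstruction on symbols, and a power of `p` makes it integral. What
remains after matching symbols has lower order and is covered by the induction. The exponent found
here depends on the operator. -/
theorem H0DFil_le_xiSaturation (d : ℕ) : ∀ P ∈ (H0DFil p m).F d, P ∈ xiSaturation p m := by
  refine H0DFil_closed_of_symb p m (N := (xiSaturation p m).toAddSubmonoid) (fun d ih P hP => ?_) d
  refine Submodule.span_induction (p := fun f _ =>
    ∃ Q ∈ (H0DFil p m).F d, Q ∈ xiSaturation p m ∧ symb p d Q = f) ?_ ?_ ?_ ?_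
    (symb_mem_lauSpan p m hP)
  · rintro _ ⟨k, hk, rfl⟩
    obtain ⟨Q, hQ, hQs⟩ := exists_symb_eq_T p m hk
    obtain ⟨R, hR, hRr, hRs⟩ := exists_xiQ_symb_eq_T p m hk
    obtain ⟨N, hN⟩ := exists_pow_norm_le p (w p m d)
    refine ⟨Q, hQ, ?_, hQs⟩
    -- Here `c = p^N w_d`, so `p^N Q` and `c R` have the same symbol of order `d`.
    set c : ℤ_[p] := ⟨_, hN⟩ with hc
    have h1 : p ^ N • Q - c • R ∈ (H0DFil p m).F d :=
      sub_mem (nsmul_mem hQ _) (Submodule.smul_mem _ _ hR)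
    have h2 : symb p d (p ^ N • Q - c • R) = 0 := by
      rw [map_sub, map_nsmul, hQs, ← algebraMap_smul ℚ_[p] c, map_smul, hRs,
        ← Nat.cast_smul_eq_nsmul ℚ_[p], smul_smul, Nat.cast_pow]
      exact sub_self _
    obtain ⟨M, hM⟩ : p ^ N • Q - c • R ∈ xiSaturation p m :=
      mem_of_mem_pred p m (N := (xiSaturation p m).toAddSubmonoid) ih (H0DFil_mem_pred p m h1 h2)
    refine ⟨M + N, ?_⟩
    -- `p^{M+N} Q` is `p^M (p^N Q - c R)` plus `p^M c R`, and both terms lie in the image.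
    have h3 := add_mem hM (nsmul_mem (Subalgebra.smul_mem _ hRr c) (p ^ M))
    rwa [← smul_add, sub_add_cancel, smul_smul, ← pow_add] at h3
  · exact ⟨0, zero_mem _, zero_mem _, map_zero _⟩
  · rintro _ _ _ _ ⟨P, hP, hP', rfl⟩ ⟨Q, hQ, hQ', rfl⟩
    exact ⟨P + Q, add_mem hP hQ, add_mem hP' hQ', map_add _ _ _⟩
  · rintro c _ _ ⟨P, hP, hP', rfl⟩
    refine ⟨c • P, Submodule.smul_mem _ _ hP, Submodule.smul_mem _ _ hP', ?_⟩
    rw [← algebraMap_smul ℚ_[p] c P, map_smul, algebraMap_smul]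

/-- Exponents that depend on the element become uniform by finite generation: take the largest one
over the finite generating set. -/
theorem exists_pow_smul_mem_xi_range :
    ∃ N : ℕ, ∀ x : H0D p m, ∃ u : Um p m, xi p m u = p ^ N • x := by
  obtain ⟨S, hS, h⟩ := H0D_generated p m
  have hx : ∀ x : H0D p m, ∃ N : ℕ, ∃ u : Um p m, xi p m u = p ^ N • x := by
    intro x
    obtain ⟨d, hd⟩ := (mem_H0D_iff p m).1 x.2
    obtain ⟨N, u, hu, e⟩ := H0DFil_le_xiSaturation p m d x.1 hd
    exact ⟨N, ⟨u, hu⟩, Subtype.ext e⟩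
  choose n hn using hx
  obtain ⟨N, hN⟩ := (hS.image n).bddAbove
  -- `K` contains the generators by the choice of `N`. It is stable under left multiplication by the
  -- image of `ξ`, since `p^N` commutes past any operator, so it is everything.
  let K : AddSubmonoid (H0D p m) :=
    { carrier := {x | ∃ u : Um p m, xi p m u = p ^ N • x}
      zero_mem' := ⟨0, by rw [map_zero, smul_zero]⟩
      add_mem' := by
        rintro x y ⟨u, hu⟩ ⟨v, hv⟩
        exact ⟨u + v, by rw [map_add, hu, hv, smul_add]⟩ }
  refine ⟨N, h K (fun x hx => ?_) ?_⟩
  · obtain ⟨u, hu⟩ := hn x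
    refine ⟨p ^ (N - n x) • u, ?_⟩
    rw [map_nsmul, hu, smul_smul, ← pow_add, Nat.sub_add_cancel (hN ⟨x, hx, rfl⟩)]
  · rintro u x ⟨v, hv⟩
    exact ⟨u * v, by rw [map_mul, hv, mul_smul_comm]⟩

/-- The image of `ξ₀` contains that of `ξ`, through the elements `u ⊗ 1`. -/
theorem exists_pow_smul_coker_xi0 :
    ∃ N : ℕ, ∀ c : H0D p m ⧸ (xi0 p m).toRingHom.toAddMonoidHom.range, p ^ N • c = 0 := by
  obtain ⟨N, hN⟩ := exists_pow_smul_mem_xi_range p m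
  refine ⟨N, fun c => ?_⟩
  obtain ⟨x, rfl⟩ := QuotientAddGroup.mk_surjective c
  obtain ⟨u, hu⟩ := hN x
  rw [← QuotientAddGroup.mk_nsmul, QuotientAddGroup.eq_zero_iff, ← hu, ← xi0_tmul_one]
  exact ⟨_, rfl⟩

end Cokernel

end ArithDiff

end

theorem mainTheorem5 (p : ℕ) [Fact p.Prime] (m : ℕ) :
    Function.Bijective (ArithDiff.symbolMap p m) ∧
    ArithDiff.FiniteVia ((ArithDiff.symbolMap p m).comp (ArithDiff.grXi p m)) ∧
    ArithDiff.FiniteVia (ArithDiff.xi0 p m).toRingHom ∧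
    ∃ N : ℕ, ∀ c : ArithDiff.H0D p m ⧸ (ArithDiff.xi0 p m).toRingHom.toAddMonoidHom.range,
      p ^ N • c = 0 :=
  ⟨ArithDiff.symbolMap_bijective p m, ArithDiff.finiteVia_grXi p m, ArithDiff.finiteVia_xi0 p m,
    ArithDiff.exists_pow_smul_coker_xi0 p m⟩
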